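/- Let $\mathbb{K}$ be $\mathbb{R}$ or $\mathbb{C}$, let $n\ge 2$, and let $T_j$ be the Chebyshev polynomials of the first kind. For $p=(p_0,\dots,p_{n-1})\in\mathbb{K}^n$ write $p(x)=T_n(x)+\sum_{j=0}^{n-1}p_jT_j(x)$ and $c=(p_{n-1},\dots,p_1,\sqrt2\,p_0)^T$. Let $H$ be the $n\times n$ symmetric tridiagonal matrix with zero diagonal and off-diagonal entries $\tfrac12,\dots,\tfrac12,\tfrac{\sqrt2}{2}$ (the last pair being $\tfrac{\sqrt2}{2}$), so that $C=H-\tfrac12e_1c^T$ is the scaled colleague matrix of $p$. For perturbations $\delta H\in\mathbb{K}^{n\times n}$ and $\delta e_1,\delta c\in\mathbb{K}^n$ let $$C+\delta C:=H+\delta H-\tfrac12(e_1+\delta e_1)(c+\delta c)^T .$$ Vector norms are Euclidean, and matrix norms are spectral. 1. If $\|\delta H\|_2\le\epsilon_H<1$, $\|\delta e_1\|_2\le\epsilon_1$ and $\|\delta c\|_2\le\epsilon_c$, then there is $\delta p=(\delta p_0,\dots,\delta p_{n-1})\in\mathbb{K}^n$ such that $$(p+\delta p)(x):=T_n(x)+\sum_{j=0}^{n-1}(p_j+\delta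 p_j)T_j(x)=2^{n-1}\det\bigl(xI-(C+\delta C)\bigr),$$ and for every $j$ $$|\delta p_j|\le\Bigl(6\|c\|_2\,\epsilon_1+2\sqrt n\,\epsilon_c+(5+16\sqrt n\,\|c\|_2)\,\epsilon_H\Bigr)n^2+K(1+\|c\|_2)\,(\epsilon_H^2+\epsilon_1^2+\epsilon_c^2),$$ where $K$ depends only on $n$. Moreover, there is $r>0$, depending only on $n$ and $p$, such that if $\epsilon_H,\epsilon_1,\epsilon_c<r$, then $xI-(C+\delta C)$ is a strong linearization of $p+\delta p$: the pencil $xI-(C+\delta C)$ is equivalent to $\mathrm{diag}((p+\delta p)(x),1,\dots,1)$, and the reversed pencil $I-x(C+\delta C)$ is equivalent to $\mathrm{diag}(x^n(p+\delta p)(1/x),1,\dots,1)$, in both cases by multiplication from the left and the right with polynomial matrices that are invertible over $\mathbb{K}[x]$. 2. Consequently, the rootfinder is backward stable if the error on the symmetric part $H$ (and that on $e_1$) is bounded independently of $p$. Precisely, there is an absolute constant $\kappa$ such that for all $n\ge2$ and $a\ge0$ there is $K$, depending only on $n$ and $a$, with the following property. For all $p$ and all $u\in[0,1]$, if $\|\delta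 H\|_2\le a u$, $\|\delta e_1\|_2\le a u$ and $\|\delta c\|_2\le a\|c\|_2u$, then $p+\delta p=2^{n-1}\det(xI-(C+\delta C))$ for some $\delta p\in\mathbb{K}^n$ with $$\|\delta p\|_2\le\kappa\,a\,n^3\,(1+\|p\|_2)\,u+K(1+\|p\|_2)\,u^2 ,$$ where $\|p\|_2$ is the norm of $(p_0,\dots,p_{n-1})$. -/

import Mathlib

open Polynomial
open scoped Matrix.Norms.L2Operator

noncomputable section

namespace Colleague

variable {𝕜 : Type*} [RCLike 𝕜]

/-- The polynomial `T_n + ∑_{j<n} p_j T_j`, monic in the basis of Chebyshev polynomials of the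
first kind. -/
def chebPoly {n : ℕ} (p : EuclideanSpace 𝕜 (Fin n)) : 𝕜[X] :=
  Chebyshev.T 𝕜 (n : ℤ) + ∑ j : Fin n, C (p j) * Chebyshev.T 𝕜 ((j : ℕ) : ℤ)

/-- The real symmetric tridiagonal matrix with zero diagonal whose off-diagonal entries are all
`1/2`, except for the last pair, which is `√2/2`. -/
def basisMatrix (𝕜 : Type*) [RCLike 𝕜] (n : ℕ) : Matrix (Fin n) (Fin n) 𝕜 :=
  Matrix.of fun i j =>
    if (i : ℕ) + 1 = j ∨ (j : ℕ) + 1 = i then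
      if (i : ℕ) + 1 = n ∨ (j : ℕ) + 1 = n then ((Real.sqrt 2 / 2 : ℝ) : 𝕜) else 1 / 2
    else 0

/-- The vector `(p_{n-1}, …, p_1, √2 p_0)`. -/
def coeffVec {n : ℕ} (p : EuclideanSpace 𝕜 (Fin n)) : EuclideanSpace 𝕜 (Fin n) :=
  WithLp.toLp 2 fun i => (if (i : ℕ) + 1 = n then ((Real.sqrt 2 : ℝ) : 𝕜) else 1) * p i.rev

/-- The first vector of the canonical basis. -/
def e₁ (𝕜 : Type*) [RCLike 𝕜] (n : ℕ) : EuclideanSpace 𝕜 (Fin n) :=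
  WithLp.toLp 2 fun i => if (i : ℕ) = 0 then 1 else 0

/-- The perturbed matrix `H + δH - ½ (e₁ + δe₁) (c + δc)ᵀ`. For `δH = 0`, `δe₁ = 0`, `δc = 0` it
is the scaled colleague matrix `H - ½ e₁ cᵀ` of `T_n + ∑_{j<n} p_j T_j`. -/
def perturbedColleague {n : ℕ} (p : EuclideanSpace 𝕜 (Fin n)) (δH : Matrix (Fin n) (Fin n) 𝕜)
    (δe δc : EuclideanSpace 𝕜 (Fin n)) : Matrix (Fin n) (Fin n) 𝕜 :=
  basisMatrix 𝕜 n + δH -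
    (1 / 2 : 𝕜) • Matrix.vecMulVec (e₁ 𝕜 n + δe).ofLp (coeffVec p + δc).ofLp

/-- The square polynomial matrix `M` is equivalent to `diag(q, 1, …, 1)` through unimodular
matrices, that is, matrices invertible over the polynomial ring. -/
def UnimodularEquivDiag {n : ℕ} (M : Matrix (Fin n) (Fin n) 𝕜[X]) (q : 𝕜[X]) : Prop :=
  ∃ E F : Matrix (Fin n) (Fin n) 𝕜[X], IsUnit E ∧ IsUnit F ∧
    E * M * F = Matrix.diagonal fun i : Fin n => if (i : ℕ) = 0 then q else 1

/-- The pencil `x I - A` is a strong linearization of the polynomial `q` of degree `n`: it is a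
linearization of `q`, and the reversed pencil `I - x A` is a linearization of the reversed
polynomial `x ^ n q(1 / x)`. -/
def IsStrongLinearization {n : ℕ} (A : Matrix (Fin n) (Fin n) 𝕜) (q : 𝕜[X]) : Prop :=
  UnimodularEquivDiag ((X : 𝕜[X]) • (1 : Matrix (Fin n) (Fin n) 𝕜[X]) - A.map C) q ∧
  UnimodularEquivDiag ((1 : Matrix (Fin n) (Fin n) 𝕜[X]) - (X : 𝕜[X]) • A.map C) (q.reflect n)

end Colleague

end

/-! The matrix `H` has the zeros `x_k = cos θ_k` of `T_n` as eigenvalues, and a real orthogonal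
matrix `U` of weighted values `T_i(x_k)` diagonalizes it. For a coefficient vector `q`, the vector
`U (coeffVec q)` lists the values of `chebPoly q` at the nodes, times `√(2/n)`. So bounding `δp`
amounts to bounding how `2^(n-1) det(x_k I - (C + δC))` moves at each node, and then applying `Uᵀ`.
Existence of `δp` is interpolation at the same nodes.

In the rotated basis this determinant is that of `diag(d) - E + ½ (e + a)(c + β)ᵀ` with `d_b = x_k -
x_b`, hence `d_k = 0`. Its expansion in principal minors keeps only index sets containing `k`. The
sets `{k}` and `{k, b}` give the unperturbed value, an explicit first order term and a second order
remainder. On larger sets at most one row can come from the rank-one part, so at least two come from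
`E`: these minors are of second order and grow only linearly in `c`.

The first order term is controlled by the geometry of the nodes: `2^(n-1) ∏ |d_b| = n / sin θ_k`,
`|e_k| = √(2/n) sin θ_k`, `sin θ_k ≥ 1/n`, and `n |x_k - x_b| ≥ sin θ_b |k - b|`. The last makes the
sums over `b` converge like `∑ 1/m²`, and Cauchy–Schwarz gives the powers of `n`.

For the strong linearization, `e₁` is a cyclic vector of the Hessenberg matrix `C`, and cyclicity is
an open condition. A cyclic vector gives a companion-type similar matrix, whose pencil and reversed
pencil each have a maximal proper minor that is a unit; block elimination then leaves `diag(q, 1, …,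
1)`. -/

namespace Matrix

/-! ### Expansion of determinants in principal minors. -/

section Expansion

variable {R ι : Type*} [CommRing R] [DecidableEq ι]

theorem det_add_eq_sum [Fintype ι] (A B : Matrix ι ι R) :
    (A + B).det = ∑ s : Finset ι, (of fun i j => if i ∈ s then A i j else B i j).det := by
  refine ((detRowAlternating : (ι → R) [⋀^ι]→ₗ[R] R).map_add_univ A.row B.row).trans
    (Finset.sum_congr rfl fun s _ => congrArg det ?_)
  ext i j
  by_cases hi : i ∈ s
  · rw [Finset.piecewise_eq_of_mem _ _ _ hi, of_apply, if_pos hi, row]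
  · rw [Finset.piecewise_eq_of_notMem _ _ _ hi, of_apply, if_neg hi, row]

/-- The principal minor of `M` on the index set `s`. -/
def principalMinor (M : Matrix ι ι R) (s : Finset ι) : R :=
  (M.submatrix (Subtype.val : s → ι) (Subtype.val : s → ι)).det

/-- In the row expansion, the rows taken from the diagonal matrix are multiples of identity rows;
pulling the factors out leaves a principal minor. -/
theorem det_diagonal_add_eq_sum_principalMinor [Fintype ι] (d : ι → R) (M : Matrix ι ι R) :
    (diagonal d + M).det = ∑ s : Finset ι, (∏ i ∈ sᶜ, d i) * M.principalMinor s := by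
  rw [add_comm, det_add_eq_sum]
  refine Finset.sum_congr rfl fun s _ => ?_
  have hs : (of fun i j => if i ∈ s then M i j else diagonal d i j) =
      of fun i j => (if i ∈ sᶜ then d i else 1) *
        of (s.piecewise M.row (1 : Matrix ι ι R).row) i j := by
    ext i j
    by_cases hi : i ∈ s
    · simp only [of_apply, Finset.mem_compl, hi, if_true, not_true_eq_false, if_false, one_mul]
      rw [Finset.piecewise_eq_of_mem _ _ _ hi, row]
    · simp only [of_apply, Finset.mem_compl, hi, if_true, not_false_eq_true, if_false]
      rw [Finset.piecewise_eq_of_notMem _ _ _ hi, row, diagonal_apply, one_apply, mul_ite, mul_one,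
        mul_zero]
  rw [hs, det_mul_column, principalMinor, ← det_piecewise_one_eq_submatrix_det]
  simp only [Finset.prod_ite_mem, Finset.univ_inter]

theorem principalMinor_singleton (M : Matrix ι ι R) (k : ι) : M.principalMinor {k} = M k k := by
  rw [principalMinor, det_eq_elem_of_card_eq_one (by simp) ⟨k, by simp⟩]
  rfl

theorem principalMinor_pair (M : Matrix ι ι R) {k b : ι} (h : k ≠ b) :
    M.principalMinor {k, b} = M k k * M b b - M k b * M b k := by
  have hbij : Function.Bijective
      (![⟨k, by simp⟩, ⟨b, by simp⟩] : Fin 2 → ({k, b} : Finset ι)) := by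
    constructor
    · intro i j
      fin_cases i <;> fin_cases j <;> simp [h, h.symm]
    · rintro ⟨x, hx⟩
      rcases Finset.mem_insert.1 hx with rfl | hx
      · exact ⟨0, rfl⟩
      · rw [Finset.mem_singleton] at hx
        subst hx
        exact ⟨1, rfl⟩
  rw [principalMinor, ← det_submatrix_equiv_self (Equiv.ofBijective _ hbij), det_fin_two]
  simp

/-- The factor `d k = 0` kills every index set that omits `k`. The surviving sets with fewer than
three elements are `{k}` and the pairs `{k, b}`. -/
theorem det_diagonal_add_of_apply_eq_zero [Fintype ι] (d : ι → R) (M : Matrix ι ι R)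
    {k : ι} (hk : d k = 0) :
    (diagonal d + M).det = (∏ i ∈ {k}ᶜ, d i) * M k k +
      ∑ b ∈ {k}ᶜ, (∏ i ∈ {k, b}ᶜ, d i) * (M k k * M b b - M k b * M b k) +
      ∑ s : Finset ι with 3 ≤ s.card, (∏ i ∈ sᶜ, d i) * M.principalMinor s := by
  classical
  rw [det_diagonal_add_eq_sum_principalMinor,
    ← Finset.sum_filter_not_add_sum_filter _ (fun s : Finset ι => 3 ≤ s.card)]
  congr 1
  have hzero : ∀ s : Finset ι, k ∉ s → (∏ i ∈ sᶜ, d i) * M.principalMinor s = 0 := fun s hs => by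
    rw [Finset.prod_eq_zero (Finset.mem_compl.2 hs) hk, zero_mul]
  have hinj : Set.InjOn (fun b => ({k, b} : Finset ι)) (({k}ᶜ : Finset ι) : Set ι) := by
    intro a ha b hb hab
    have : a ∈ ({k, b} : Finset ι) := by
      have h : a ∈ ({k, a} : Finset ι) := by simp
      rwa [show ({k, a} : Finset ι) = {k, b} from hab] at h
    simp at ha hb this
    tauto
  have hsum : ∑ b ∈ {k}ᶜ, (∏ i ∈ {k, b}ᶜ, d i) * (M k k * M b b - M k b * M b k) =
      ∑ s ∈ ({k}ᶜ : Finset ι).image (fun b => ({k, b} : Finset ι)),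
        (∏ i ∈ sᶜ, d i) * M.principalMinor s := by
    rw [Finset.sum_image hinj]
    refine Finset.sum_congr rfl fun b hb => ?_
    rw [principalMinor_pair M (fun h => by simp [h] at hb)]
  have hnot : ({k} : Finset ι) ∉ ({k}ᶜ : Finset ι).image (fun b => ({k, b} : Finset ι)) := by
    intro h
    obtain ⟨b, hb, h⟩ := Finset.mem_image.1 h
    have : b ∈ ({k} : Finset ι) := h ▸ by simp
    simp_all
  rw [hsum, ← principalMinor_singleton M k,
    ← Finset.sum_insert (f := fun s => (∏ i ∈ sᶜ, d i) * M.principalMinor s) hnot]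
  symm
  refine Finset.sum_subset ?_ fun s hs hs' => hzero s fun hks => hs' ?_
  · intro s hs
    rw [Finset.mem_filter]
    refine ⟨Finset.mem_univ _, ?_⟩
    rcases Finset.mem_insert.1 hs with rfl | hs
    · simp
    · obtain ⟨b, hb, rfl⟩ := Finset.mem_image.1 hs
      have := Finset.card_le_two (a := k) (b := b)
      omega
  · have hcard : s.card < 3 := by simpa using hs
    rw [Finset.mem_insert, Finset.mem_image]
    have hpos : 0 < s.card := Finset.card_pos.2 ⟨k, hks⟩
    have : s.card = 1 ∨ s.card = 2 := by omega
    rcases this with h | h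
    · obtain ⟨x, rfl⟩ := Finset.card_eq_one.1 h
      left
      simp_all
    · right
      obtain ⟨x, y, hxy, rfl⟩ := Finset.card_eq_two.1 h
      rcases Finset.mem_insert.1 hks with rfl | hy
      · exact ⟨y, by simpa using hxy.symm, rfl⟩
      · rw [Finset.mem_singleton] at hy
        subst hy
        exact ⟨x, by simpa using hxy, Finset.pair_comm _ _⟩

end Expansion

/-! ### Determinants of small matrices plus a rank-one matrix. -/

section Norm

variable {𝕜 ι : Type*} [RCLike 𝕜] [Fintype ι] [DecidableEq ι]

theorem norm_det_le_of_row_bound (M : Matrix ι ι 𝕜) (r : ι → ℝ) (h : ∀ i j, ‖M i j‖ ≤ r i) :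
    ‖M.det‖ ≤ (Fintype.card ι).factorial * ∏ i, r i := by
  rw [← det_transpose, det_apply]
  refine (norm_sum_le _ _).trans ?_
  refine (Finset.sum_le_card_nsmul _ _ (∏ i, r i) fun σ _ => ?_).trans ?_
  · have : ‖Equiv.Perm.sign σ • ∏ i, Mᵀ (σ i) i‖ = ∏ i, ‖M i (σ i)‖ := by
      rcases Int.units_eq_one_or (Equiv.Perm.sign σ) with h | h <;> simp [h, norm_prod]
    rw [this]
    exact Finset.prod_le_prod (fun _ _ => norm_nonneg _) fun i _ => h i _
  · simp [Finset.card_univ, Fintype.card_perm]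

/-- Two rows taken from the rank-one part are proportional, so nonzero terms use at most one of
them. With at least three rows, this leaves two rows of size `ε` and at most one factor `U`. -/
theorem norm_det_add_vecMulVec_le (A : Matrix ι ι 𝕜) (u v : ι → 𝕜) {B ε U : ℝ}
    (hι : 3 ≤ Fintype.card ι) (hB : 1 ≤ B) (hε : ε ≤ B) (hA : ∀ i j, ‖A i j‖ ≤ ε)
    (hU : ∀ i j, ‖u i * v j‖ ≤ U) :
    ‖(A + vecMulVec u v).det‖ ≤
      2 ^ Fintype.card ι * (Fintype.card ι).factorial * B ^ Fintype.card ι *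
        (ε ^ 2 * (1 + U)) := by
  have : Nonempty ι := Fintype.card_pos_iff.1 (by omega)
  obtain ⟨i₀⟩ := this
  have hε0 : 0 ≤ ε := (norm_nonneg _).trans (hA i₀ i₀)
  have hU0 : 0 ≤ U := (norm_nonneg _).trans (hU i₀ i₀)
  -- Powers of `ε` beyond the second are traded for powers of `B ≥ 1`.
  have hpow : ∀ m : ℕ, 2 ≤ m → m ≤ Fintype.card ι → ε ^ m ≤ ε ^ 2 * B ^ Fintype.card ι := by
    intro m hm hm'
    obtain ⟨l, rfl⟩ := Nat.exists_eq_add_of_le hm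
    rw [pow_add]
    gcongr
    exact (pow_le_pow_left₀ hε0 hε l).trans (pow_le_pow_right₀ hB (by omega))
  have hterm : ∀ s : Finset ι,
      ‖(of fun i j => if i ∈ s then A i j else vecMulVec u v i j).det‖ ≤
        (Fintype.card ι).factorial * B ^ Fintype.card ι * (ε ^ 2 * (1 + U)) := by
    intro s
    by_cases hs : 2 ≤ sᶜ.card
    · have hsm : (of fun i j => if i ∈ s then A i j else vecMulVec u v i j) =
          of fun i j => (if i ∈ sᶜ then u i else 1) *
            of (fun i j => if i ∈ s then A i j else v j) i j := by
        ext i j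
        by_cases hi : i ∈ s <;> simp [hi, vecMulVec_apply]
      obtain ⟨i, hi, j, hj, hij⟩ := Finset.one_lt_card.1 hs
      rw [Finset.mem_compl] at hi hj
      rw [hsm, det_mul_column, det_zero_of_row_eq hij (by ext; simp [hi, hj]), mul_zero, norm_zero]
      positivity
    · have hle := norm_det_le_of_row_bound
        (of fun i j => if i ∈ s then A i j else vecMulVec u v i j)
        (fun i => if i ∈ s then ε else U) (fun i j => by
          by_cases hi : i ∈ s
          · simpa [hi] using hA i j
          · simpa [hi, vecMulVec_apply] using hU i j)
      refine hle.trans ?_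
      rw [mul_assoc]
      gcongr
      rw [Finset.prod_ite]
      simp only [Finset.prod_const, Finset.filter_mem_eq_inter, Finset.univ_inter]
      have hc : s.card + sᶜ.card = Fintype.card ι := Finset.card_add_card_compl s
      have hfil : (Finset.univ.filter fun i => i ∉ s) = sᶜ := by ext; simp
      rw [hfil]
      have h1 := hpow s.card (by omega) (by omega)
      have h2 : U ^ sᶜ.card ≤ 1 + U := by
        have : sᶜ.card = 0 ∨ sᶜ.card = 1 := by omega
        rcases this with h | h <;> rw [h] <;> simp [hU0]
      calc ε ^ s.card * U ^ sᶜ.card ≤ (ε ^ 2 * B ^ Fintype.card ι) * (1 + U) := by gcongr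
        _ = _ := by ring
  calc ‖(A + vecMulVec u v).det‖
      = ‖∑ s : Finset ι, (of fun i j => if i ∈ s then A i j else vecMulVec u v i j).det‖ := by
        rw [det_add_eq_sum]
    _ ≤ _ := (norm_sum_le _ _).trans (Finset.sum_le_card_nsmul _ _ _ fun s _ => hterm s)
    _ = _ := by
      simp only [Finset.card_univ, Fintype.card_finset, nsmul_eq_mul, Nat.cast_pow, Nat.cast_ofNat]
      ring

end Norm

end Matrix

namespace Colleague

open Real

/-! ### Geometry of the Chebyshev nodes and eigenvectors of `H`. -/

section Nodes

variable {n : ℕ}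

/-- The angle of the `k`-th Chebyshev node. -/
noncomputable def angle (k : Fin n) : ℝ := (2 * (k : ℕ) + 1) * π / (2 * n)

/-- The `k`-th root of the Chebyshev polynomial `T_n`. -/
noncomputable def node (k : Fin n) : ℝ := cos (angle k)

theorem angle_pos (k : Fin n) : 0 < angle k := by
  have : 0 < n := k.pos
  unfold angle
  positivity

theorem natCast_mul_angle (k : Fin n) : (n : ℝ) * angle k = k * π + π / 2 := by
  have : (n : ℝ) ≠ 0 := by exact_mod_cast k.pos.ne'
  unfold angle
  field_simp

theorem angle_lt_pi (k : Fin n) : angle k < π := by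
  have hn : (0 : ℝ) < n := by exact_mod_cast k.pos
  have hk : ((k : ℕ) : ℝ) + 1 ≤ n := by exact_mod_cast k.isLt
  have h := natCast_mul_angle k
  have := pi_pos
  by_contra! hle
  nlinarith

theorem cos_natCast_mul_angle (k : Fin n) : cos (n * angle k) = 0 := by
  rw [natCast_mul_angle, cos_add_pi_div_two, sin_nat_mul_pi, neg_zero]

theorem sin_natCast_mul_angle_sq (k : Fin n) : sin (n * angle k) ^ 2 = 1 := by
  have := sin_sq_add_cos_sq (n * angle k)
  rwa [cos_natCast_mul_angle, zero_pow two_ne_zero, add_zero] at this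

theorem sin_angle_pos (k : Fin n) : 0 < sin (angle k) :=
  sin_pos_of_pos_of_lt_pi (angle_pos k) (angle_lt_pi k)

/-- Jordan's inequality `sin t ≥ 2t/π` on `[0, π/2]`, after reflecting angles beyond `π/2`: every
angle is at distance at least `π/(2n)` from `0` and `π`. -/
theorem inv_le_sin_angle (k : Fin n) : (n : ℝ)⁻¹ ≤ sin (angle k) := by
  have hn : (0 : ℝ) < n := by exact_mod_cast k.pos
  have hk : ((k : ℕ) : ℝ) + 1 ≤ n := by exact_mod_cast k.isLt
  have h := natCast_mul_angle k
  have hpi := pi_pos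
  rcases le_total (angle k) (π / 2) with hle | hle
  · refine le_trans ?_ (mul_le_sin (angle_pos k).le hle)
    have : (0 : ℝ) ≤ (k : ℕ) * π := by positivity
    rw [inv_le_iff_one_le_mul₀ hn, div_mul_eq_mul_div, div_mul_eq_mul_div, le_div_iff₀ hpi]
    nlinarith
  · rw [← sin_pi_sub]
    refine le_trans ?_ (mul_le_sin (sub_nonneg.2 (angle_lt_pi k).le) (by linarith))
    have : (((k : ℕ) : ℝ) + 1) * π ≤ n * π := by gcongr
    rw [inv_le_iff_one_le_mul₀ hn, div_mul_eq_mul_div, div_mul_eq_mul_div, le_div_iff₀ hpi]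
    nlinarith

theorem angle_sub_angle (k b : Fin n) :
    angle k - angle b = (((k : ℕ) : ℝ) - (b : ℕ)) * π / n := by
  have : (n : ℝ) ≠ 0 := by exact_mod_cast k.pos.ne'
  unfold angle
  field_simp
  ring

/-- The difference of cosines factors into sines of the half-sum and the half-difference. Jordan's
inequality bounds the second below by `|k - b|/n`. -/
theorem sin_angle_mul_abs_sub_le (k b : Fin n) :
    sin (angle b) * |((k : ℕ) : ℝ) - (b : ℕ)| ≤ n * |node k - node b| := by
  have hn : (0 : ℝ) < n := by exact_mod_cast k.pos
  have hhalf : |((k : ℕ) : ℝ) - (b : ℕ)| ≤ n * |sin ((angle k - angle b) / 2)| := by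
    have hkey : ∀ x y : Fin n, (y : ℕ) ≤ (x : ℕ) →
        |((x : ℕ) : ℝ) - (y : ℕ)| ≤ n * |sin ((angle x - angle y) / 2)| := by
      intro x y hxy
      have hxy' : ((y : ℕ) : ℝ) ≤ (x : ℕ) := by exact_mod_cast hxy
      have hx : ((x : ℕ) : ℝ) ≤ n := by exact_mod_cast x.isLt.le
      have hy : (0 : ℝ) ≤ (y : ℕ) := by positivity
      have h0 : 0 ≤ (angle x - angle y) / 2 := by
        rw [angle_sub_angle]
        have := sub_nonneg.2 hxy'
        positivity
      have h1 : (angle x - angle y) / 2 ≤ π / 2 := by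
        have := angle_lt_pi x
        have := angle_pos y
        linarith
      have := mul_le_sin h0 h1
      rw [abs_of_nonneg (sub_nonneg.2 hxy')]
      calc ((x : ℕ) : ℝ) - (y : ℕ) = n * (2 / π * ((angle x - angle y) / 2)) := by
            rw [angle_sub_angle]
            field_simp
        _ ≤ n * |sin ((angle x - angle y) / 2)| := by
            gcongr
            exact this.trans (le_abs_self _)
    rcases le_total (b : ℕ) (k : ℕ) with h | h
    · exact hkey k b h
    · have := hkey b k h
      rwa [abs_sub_comm, ← neg_sub (angle k), neg_div, sin_neg, abs_neg] at this
  -- From `sin θ_k + sin θ_b = 2 sin((θ_k + θ_b)/2) cos((θ_k - θ_b)/2)`, with the cosine at most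
  -- `1`.
  have hsin : sin (angle b) ≤ 2 * sin ((angle k + angle b) / 2) := by
    have h1 := sin_add_sin (angle k) (angle b)
    have h2 := sin_angle_pos k
    have h3 : 0 ≤ sin ((angle k + angle b) / 2) :=
      sin_nonneg_of_nonneg_of_le_pi (by linarith [angle_pos k, angle_pos b])
        (by linarith [angle_lt_pi k, angle_lt_pi b])
    have h4 := cos_le_one ((angle k - angle b) / 2)
    nlinarith
  have hsin0 := (sin_angle_pos b).le
  have h2 : |node k - node b| =
      2 * sin ((angle k + angle b) / 2) * |sin ((angle k - angle b) / 2)| := by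
    rw [node, node, cos_sub_cos, abs_mul, abs_mul, abs_neg, abs_two, abs_of_nonneg (by linarith)]
  calc sin (angle b) * |((k : ℕ) : ℝ) - (b : ℕ)|
      ≤ (2 * sin ((angle k + angle b) / 2)) * (n * |sin ((angle k - angle b) / 2)|) := by
        gcongr
        linarith
    _ = _ := by rw [h2]; ring

theorem node_injective : Function.Injective (node : Fin n → ℝ) := by
  intro k b h
  have := sin_angle_mul_abs_sub_le k b
  rw [h, sub_self, abs_zero, mul_zero] at this
  have h0 : |((k : ℕ) : ℝ) - (b : ℕ)| ≤ 0 := nonpos_of_mul_nonpos_right this (sin_angle_pos b)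
  have h1 := sub_eq_zero.1 (abs_nonpos_iff.1 h0)
  exact Fin.ext (by exact_mod_cast h1)

theorem abs_node_sub_node_le (k b : Fin n) : |node k - node b| ≤ 2 := by
  rw [abs_le]
  unfold node
  constructor <;> linarith [cos_le_one (angle k), cos_le_one (angle b), neg_one_le_cos (angle k),
    neg_one_le_cos (angle b)]

/-- The indices below `k` and those above `k` each contribute at most `∑ 1/m² ≤ 2`. -/
theorem sum_inv_sq_sub_le (k : Fin n) :
    ∑ b ∈ {k}ᶜ, |((k : ℕ) : ℝ) - (b : ℕ)|⁻¹ ^ 2 ≤ 4 := by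
  have key : ∀ (s : Finset (Fin n)) (g : Fin n → ℕ), Set.InjOn g s →
      (∀ b ∈ s, 0 < g b ∧ g b < n ∧ |((k : ℕ) : ℝ) - (b : ℕ)| = g b) →
      ∑ b ∈ s, |((k : ℕ) : ℝ) - (b : ℕ)|⁻¹ ^ 2 ≤ 2 := by
    intro s g hg h
    calc ∑ b ∈ s, |((k : ℕ) : ℝ) - (b : ℕ)|⁻¹ ^ 2 = ∑ b ∈ s, ((g b : ℝ) ^ 2)⁻¹ :=
          Finset.sum_congr rfl fun b hb => by rw [(h b hb).2.2, inv_pow]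
      _ = ∑ m ∈ s.image g, ((m : ℝ) ^ 2)⁻¹ :=
          (Finset.sum_image (f := fun m : ℕ => ((m : ℝ) ^ 2)⁻¹) hg).symm
      _ ≤ ∑ m ∈ Finset.Ioo 0 n, ((m : ℝ) ^ 2)⁻¹ := by
          refine Finset.sum_le_sum_of_subset_of_nonneg (fun m hm => ?_) fun _ _ _ => by positivity
          obtain ⟨b, hb, rfl⟩ := Finset.mem_image.1 hm
          exact Finset.mem_Ioo.2 ⟨(h b hb).1, (h b hb).2.1⟩
      _ ≤ 2 := (sum_Ioo_inv_sq_le 0 n).trans (by norm_num)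
  have hsplit : ({k}ᶜ : Finset (Fin n)) = Finset.Iio k ∪ Finset.Ioi k := by
    ext b
    simp
  rw [hsplit, Finset.sum_union (Finset.disjoint_left.2 fun b hb hb' =>
    (Finset.mem_Iio.1 hb).not_gt (Finset.mem_Ioi.1 hb'))]
  have h1 := key (Finset.Iio k) (fun b => k - b) (fun a ha b hb hab => by
      simp only [Finset.coe_Iio, Set.mem_Iio] at ha hb
      dsimp only at hab
      omega) fun b hb => by
    have hb := Finset.mem_Iio.1 hb
    refine ⟨by omega, by omega, ?_⟩
    rw [Nat.cast_sub (by omega), abs_of_nonneg (sub_nonneg.2 (by exact_mod_cast hb.le))]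
  have h2 := key (Finset.Ioi k) (fun b => b - k) (fun a ha b hb hab => by
      simp only [Finset.coe_Ioi, Set.mem_Ioi] at ha hb
      dsimp only at hab
      omega) fun b hb => by
    have hb := Finset.mem_Ioi.1 hb
    refine ⟨by omega, by omega, ?_⟩
    rw [Nat.cast_sub (by omega), abs_sub_comm, abs_of_nonneg (sub_nonneg.2 (by exact_mod_cast hb.le))]
  linarith

theorem sum_cos_intCast_mul_angle {m : ℤ} (hm : ¬ (2 * n : ℤ) ∣ m) :
    ∑ k : Fin n, cos (m * angle k) = 0 := by
  rcases eq_or_ne n 0 with rfl | hn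
  · simp
  have h := Chebyshev.sumZeroes_T_of_not_dvd hm
  rw [Chebyshev.sumZeroes, mul_eq_zero_iff_left (by positivity)] at h
  rw [← h, ← Fin.sum_univ_eq_sum_range
    (fun i => (Chebyshev.T ℝ m).eval (cos ((2 * (i : ℝ) + 1) / (2 * n) * π)))]
  refine Finset.sum_congr rfl fun k _ => ?_
  rw [Chebyshev.T_real_cos, angle]
  congr 2
  ring

theorem T_eq_prod_node :
    Chebyshev.T ℝ (n : ℤ) = C ((2 : ℝ) ^ (n - 1)) * Lagrange.nodal Finset.univ (node (n := n)) := by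
  have hdeg : (Chebyshev.T ℝ (n : ℤ)).natDegree = n := by simp
  have hroots : (Chebyshev.T ℝ (n : ℤ)).roots = (Finset.univ.image (node (n := n))).val := by
    rw [Chebyshev.roots_T_real]
    congr 1
    ext x
    simp only [Finset.mem_image, Finset.mem_range, Finset.mem_univ, true_and]
    exact ⟨fun ⟨k, hk, h⟩ => ⟨⟨k, hk⟩, h⟩, fun ⟨k, h⟩ => ⟨k, k.isLt, h⟩⟩
  have hcard : (Chebyshev.T ℝ (n : ℤ)).roots.card = (Chebyshev.T ℝ (n : ℤ)).natDegree := by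
    rw [hdeg, hroots, Finset.card_val, Finset.card_image_of_injective _ node_injective,
      Finset.card_univ, Fintype.card_fin]
  rw [← C_leadingCoeff_mul_prod_multiset_X_sub_C hcard, Chebyshev.leadingCoeff_T, hroots,
    Lagrange.nodal_eq, Int.natAbs_natCast,
    ← Finset.prod_image (s := Finset.univ) (g := node) (f := fun x => X - C x)
      fun x _ y _ h => node_injective h]
  rfl

/-- Both sides compute `T_n'(x_k) sin θ_k`: once from the factorization of `T_n`, once from `T_n' =
n U_{n-1}` and `U_{n-1}(cos θ) sin θ = sin nθ`. -/
theorem prod_node_sub_node (k : Fin n) :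
    2 ^ (n - 1) * (∏ b ∈ {k}ᶜ, (node k - node b)) * sin (angle k) = n * sin (n * angle k) := by
  have h := congrArg (fun p => eval (node k) (derivative p)) (T_eq_prod_node (n := n))
  simp only [derivative_C_mul, eval_mul, eval_C,
    Lagrange.eval_nodal_derivative_eval_node_eq (Finset.mem_univ k), Lagrange.eval_nodal,
    Chebyshev.T_derivative_eq_U] at h
  have he : (Finset.univ.erase k) = ({k}ᶜ : Finset (Fin n)) := by ext; simp
  rw [← he, ← h, node, mul_assoc, Chebyshev.U_real_cos]
  simp

/-- The scaling of the `i`-th entry in the eigenvectors of `basisMatrix`. -/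
noncomputable def eigenWeight (i : Fin n) : ℝ := if (i : ℕ) + 1 = n then (√2)⁻¹ else 1

/-- The orthogonal matrix whose rows are the normalized eigenvectors of `basisMatrix`. -/
noncomputable def eigenMatrix (n : ℕ) : Matrix (Fin n) (Fin n) ℝ :=
  Matrix.of fun k i => √(2 / n) * (eigenWeight i * cos ((i.rev : ℕ) * angle k))

/-- Discrete orthogonality: product-to-sum formulas turn each entry into cosine sums of frequencies
`i.rev ± j.rev`, which vanish unless `2n` divides the frequency. The weight `1/√2` corrects the
constant function, for which both frequencies are zero. -/
theorem eigenMatrix_transpose_mul_self (n : ℕ) : (eigenMatrix n).transpose * eigenMatrix n = 1 := by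
  ext i j
  have hn : (0 : ℝ) < n := by exact_mod_cast i.pos
  have hs : √(2 / n : ℝ) ^ 2 = 2 / n := sq_sqrt (by positivity)
  have hsum : ((eigenMatrix n).transpose * eigenMatrix n) i j =
      (n : ℝ)⁻¹ * (eigenWeight i * eigenWeight j) *
        (∑ k : Fin n, cos ((((i.rev : ℕ) : ℤ) - ((j.rev : ℕ) : ℤ) : ℤ) * angle k) +
         ∑ k : Fin n, cos ((((i.rev : ℕ) : ℤ) + ((j.rev : ℕ) : ℤ) : ℤ) * angle k)) := by
    rw [Matrix.mul_apply, ← Finset.sum_add_distrib, Finset.mul_sum]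
    refine Finset.sum_congr rfl fun k _ => ?_
    have h := two_mul_cos_mul_cos ((i.rev : ℕ) * angle k) ((j.rev : ℕ) * angle k)
    push_cast
    rw [sub_mul, add_mul, ← h, Matrix.transpose_apply, eigenMatrix, Matrix.of_apply, Matrix.of_apply]
    linear_combination (eigenWeight i * eigenWeight j * cos ((i.rev : ℕ) * angle k) *
      cos ((j.rev : ℕ) * angle k)) * hs
  have hi : ((i.rev : ℕ) : ℤ) = n - (i + 1) := by rw [Fin.val_rev]; omega
  have hj : ((j.rev : ℕ) : ℤ) = n - (j + 1) := by rw [Fin.val_rev]; omega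
  rw [hsum, Matrix.one_apply]
  split_ifs with hij
  · subst hij
    rw [sub_self]
    by_cases hlast : (i : ℕ) + 1 = n
    · have h0 : ((i.rev : ℕ) : ℤ) = 0 := by omega
      have h2 : (√2 : ℝ)⁻¹ * (√2)⁻¹ = 1 / 2 := by
        rw [← mul_inv, mul_self_sqrt zero_le_two, one_div]
      simp only [h0, eigenWeight, hlast, if_true, h2]
      simp
      field_simp
      ring
    · rw [sum_cos_intCast_mul_angle (m := ((i.rev : ℕ) : ℤ) + ((i.rev : ℕ) : ℤ)) (by
        rw [← two_mul, Int.mul_dvd_mul_iff_left two_ne_zero]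
        intro h
        have := Int.le_of_dvd (by omega) h
        omega)]
      simp [eigenWeight, hlast, hn.ne']
  · have hne : (i : ℕ) ≠ j := fun h => hij (Fin.ext h)
    rw [sum_cos_intCast_mul_angle, sum_cos_intCast_mul_angle, add_zero, mul_zero]
    · intro h
      have := Int.le_of_dvd (by omega) h
      omega
    · intro h
      have := Int.le_of_dvd (abs_pos.2 (by omega)) ((dvd_abs _ _).2 h)
      rcases abs_cases (((i.rev : ℕ) : ℤ) - ((j.rev : ℕ) : ℤ)) with h | h <;> omega

/-- This is the recurrence `2 cos θ cos mθ = cos (m-1)θ + cos (m+1)θ`. In the first row the missing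
neighbour would be `cos nθ_k = 0`; in the last row the entry `√2/2` matches the weight of `T_0`. -/
theorem basisMatrix_mul_eigenMatrix_transpose (hn : 2 ≤ n) :
    basisMatrix ℝ n * (eigenMatrix n).transpose =
      (eigenMatrix n).transpose * Matrix.diagonal node := by
  ext i k
  rw [Matrix.mul_diagonal, Matrix.mul_apply]
  simp only [Matrix.transpose_apply]
  have h2 : (√2 / 2 : ℝ) = (√2)⁻¹ := by
    rw [div_eq_iff two_ne_zero, eq_comm, inv_mul_eq_iff_eq_mul₀ (by positivity)]
    exact (mul_self_sqrt zero_le_two).symm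
  have h2' : (√2 : ℝ)⁻¹ * (√2)⁻¹ = 1 / 2 := by
    rw [← mul_inv, mul_self_sqrt zero_le_two, one_div]
  -- the contributions of the right and of the left neighbours
  have hR : ∑ j : Fin n, (if (i : ℕ) + 1 = j then basisMatrix ℝ n i j * eigenMatrix n k j else 0) =
      1 / 2 * √(2 / n) * (if (i : ℕ) + 1 = n then 0 else
        cos ((((i.rev : ℕ) : ℝ) - 1) * angle k)) := by
    by_cases hi : (i : ℕ) + 1 = n
    · rw [if_pos hi, mul_zero]
      refine Finset.sum_eq_zero fun j _ => if_neg ?_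
      omega
    · have hlt : (i : ℕ) + 1 < n := by omega
      rw [Finset.sum_eq_single ⟨i + 1, hlt⟩ (fun j _ hj => if_neg fun h => hj (Fin.ext h.symm))
        (by simp)]
      rw [if_neg hi, if_pos rfl]
      have hrev : (((⟨i + 1, hlt⟩ : Fin n).rev : ℕ) : ℝ) = ((i.rev : ℕ) : ℝ) - 1 := by
        rw [Fin.val_rev, Fin.val_rev, Nat.cast_sub (by simp; omega), Nat.cast_sub (by omega)]
        push_cast
        ring
      simp only [eigenMatrix, Matrix.of_apply, basisMatrix, hrev, eigenWeight, true_or, if_true, hi,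
        false_or]
      split_ifs
      · simp only [RCLike.ofReal_real_eq_id, id, h2]
        linear_combination √(2 / n) * cos ((((i.rev : ℕ) : ℝ) - 1) * angle k) * h2'
      · ring
  have hL : ∑ j : Fin n, (if (j : ℕ) + 1 = i then basisMatrix ℝ n i j * eigenMatrix n k j else 0) =
      √(2 / n) * (if (i : ℕ) + 1 = n then (√2)⁻¹ else 1 / 2) *
        cos ((((i.rev : ℕ) : ℝ) + 1) * angle k) := by
    by_cases hi : (i : ℕ) = 0
    · rw [Finset.sum_eq_zero fun j _ => if_neg (by omega)]
      have hrev : (((i.rev : ℕ) : ℝ) + 1) = n := by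
        rw [Fin.val_rev, hi, Nat.cast_sub (by omega)]
        push_cast
        ring
      rw [hrev, cos_natCast_mul_angle, mul_zero]
    · have hlt : (i : ℕ) - 1 < n := by omega
      rw [Finset.sum_eq_single ⟨i - 1, hlt⟩
        (fun j _ hj => if_neg fun h => hj (Fin.ext (by simp; omega))) (by simp)]
      have hi' : (i : ℕ) - 1 + 1 = i := by omega
      have hin : (i : ℕ) ≠ n := by omega
      have hrev : (((⟨i - 1, hlt⟩ : Fin n).rev : ℕ) : ℝ) = ((i.rev : ℕ) : ℝ) + 1 := by
        rw [Fin.val_rev, Fin.val_rev, Nat.cast_sub (by simp; omega), Nat.cast_sub (by omega)]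
        simp only [hi']
        push_cast
        ring
      simp only [eigenMatrix, Matrix.of_apply, basisMatrix, hrev, eigenWeight, hi', or_true, if_true,
        hin, if_false, or_false]
      split_ifs
      · simp only [RCLike.ofReal_real_eq_id, id, h2]
        ring
      · ring
  have hsplit : ∀ j, basisMatrix ℝ n i j * eigenMatrix n k j =
      (if (i : ℕ) + 1 = j then basisMatrix ℝ n i j * eigenMatrix n k j else 0) +
      (if (j : ℕ) + 1 = i then basisMatrix ℝ n i j * eigenMatrix n k j else 0) := by
    intro j
    by_cases h1 : (i : ℕ) + 1 = j
    · rw [if_pos h1, if_neg (by omega), add_zero]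
    · by_cases h3 : (j : ℕ) + 1 = i
      · rw [if_neg h1, if_pos h3, zero_add]
      · rw [if_neg h1, if_neg h3, basisMatrix, Matrix.of_apply, if_neg (by tauto)]
        simp
  rw [Finset.sum_congr rfl fun j _ => hsplit j, Finset.sum_add_distrib, hR, hL, eigenMatrix,
    Matrix.of_apply, eigenWeight, node]
  by_cases hi : (i : ℕ) + 1 = n
  · have hrev : ((i.rev : ℕ) : ℝ) = 0 := by
      rw [Fin.val_rev, hi, Nat.sub_self, Nat.cast_zero]
    simp only [hi, if_true, hrev]
    simp
  · simp only [hi, if_false]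
    rw [sub_mul, add_mul, one_mul, cos_sub, cos_add]
    ring

end Nodes

/-! ### Coefficients versus values at the nodes. -/

section Eigenvectors

variable {n : ℕ} (𝕜 : Type*) [RCLike 𝕜]

/-- The orthogonal matrix `eigenMatrix n` with entries in `𝕜`. -/
noncomputable def eigenMatrixCoe (n : ℕ) : Matrix (Fin n) (Fin n) 𝕜 :=
  (eigenMatrix n).map (algebraMap ℝ 𝕜)

theorem eigenMatrixCoe_transpose_mul_self (n : ℕ) :
    (eigenMatrixCoe 𝕜 n).transpose * eigenMatrixCoe 𝕜 n = 1 := by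
  rw [eigenMatrixCoe, ← Matrix.transpose_map, ← Matrix.map_mul, eigenMatrix_transpose_mul_self,
    Matrix.map_one _ (map_zero _) (map_one _)]

theorem eigenMatrixCoe_mul_transpose (n : ℕ) :
    eigenMatrixCoe 𝕜 n * (eigenMatrixCoe 𝕜 n).transpose = 1 :=
  mul_eq_one_comm.1 (eigenMatrixCoe_transpose_mul_self 𝕜 n)

theorem eigenMatrixCoe_mul_basisMatrix_mul_transpose (hn : 2 ≤ n) :
    eigenMatrixCoe 𝕜 n * basisMatrix 𝕜 n * (eigenMatrixCoe 𝕜 n).transpose =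
      Matrix.diagonal fun k => ((node k : ℝ) : 𝕜) := by
  have hb : basisMatrix 𝕜 n = (basisMatrix ℝ n).map (algebraMap ℝ 𝕜) := by
    ext i j
    simp only [basisMatrix, Matrix.of_apply, Matrix.map_apply]
    split_ifs <;> simp [map_ofNat]
  have hd : (Matrix.diagonal fun k => ((node k : ℝ) : 𝕜)) =
      (Matrix.diagonal (node (n := n))).map (algebraMap ℝ 𝕜) := by
    rw [Matrix.diagonal_map (map_zero _)]
  rw [Matrix.mul_assoc, hb, hd, eigenMatrixCoe, ← Matrix.transpose_map, ← Matrix.map_mul,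
    basisMatrix_mul_eigenMatrix_transpose hn, Matrix.map_mul, ← Matrix.mul_assoc,
    Matrix.transpose_map]
  change eigenMatrixCoe 𝕜 n * (eigenMatrixCoe 𝕜 n).transpose * _ = _
  rw [eigenMatrixCoe_mul_transpose, one_mul]

theorem eigenMatrixCoe_conjTranspose (n : ℕ) :
    (eigenMatrixCoe 𝕜 n).conjTranspose = (eigenMatrixCoe 𝕜 n).transpose := by
  ext i j
  simp [eigenMatrixCoe, Matrix.conjTranspose_apply]

theorem norm_eigenMatrixCoe_le_one (n : ℕ) : ‖eigenMatrixCoe 𝕜 n‖ ≤ 1 := by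
  have h := Matrix.l2_opNorm_conjTranspose_mul_self (eigenMatrixCoe 𝕜 n)
  rw [eigenMatrixCoe_conjTranspose, eigenMatrixCoe_transpose_mul_self] at h
  have h1 : ‖(1 : Matrix (Fin n) (Fin n) 𝕜)‖ ≤ 1 := by
    rw [← Matrix.diagonal_one, Matrix.l2_opNorm_diagonal]
    exact (pi_norm_le_iff_of_nonneg zero_le_one).2 fun _ => by simp
  nlinarith [norm_nonneg (eigenMatrixCoe 𝕜 n)]

theorem norm_eigenMatrixCoe_mulVec_le (v : EuclideanSpace 𝕜 (Fin n)) :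
    ‖WithLp.toLp 2 ((eigenMatrixCoe 𝕜 n).mulVec v.ofLp)‖ ≤ ‖v‖ :=
  (Matrix.l2_opNorm_mulVec _ v).trans
    (mul_le_of_le_one_left (norm_nonneg _) (norm_eigenMatrixCoe_le_one 𝕜 n))

theorem norm_eigenMatrixCoe_conj_le (E : Matrix (Fin n) (Fin n) 𝕜) :
    ‖eigenMatrixCoe 𝕜 n * E * (eigenMatrixCoe 𝕜 n).transpose‖ ≤ ‖E‖ := by
  have h := norm_eigenMatrixCoe_le_one 𝕜 n
  have h' : ‖(eigenMatrixCoe 𝕜 n).transpose‖ ≤ 1 := by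
    rwa [← eigenMatrixCoe_conjTranspose, Matrix.l2_opNorm_conjTranspose]
  refine (Matrix.l2_opNorm_mul _ _).trans ((mul_le_of_le_one_right (norm_nonneg _) h').trans ?_)
  exact (Matrix.l2_opNorm_mul _ _).trans (mul_le_of_le_one_left (norm_nonneg _) h)

variable {𝕜}

/-- Conjugation by `U`. As `U` is real, its inverse is the plain transpose, which suits the
unconjugated product `(e₁ + δe)(c + δc)ᵀ` even over the complex numbers. -/
theorem eval_charpoly_perturbedColleague (hn : 2 ≤ n) (p : EuclideanSpace 𝕜 (Fin n))
    (δH : Matrix (Fin n) (Fin n) 𝕜) (δe δc : EuclideanSpace 𝕜 (Fin n)) (x : 𝕜) :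
    (perturbedColleague p δH δe δc).charpoly.eval x =
      (Matrix.diagonal (fun b => x - ((node b : ℝ) : 𝕜)) +
        (-(eigenMatrixCoe 𝕜 n * δH * (eigenMatrixCoe 𝕜 n).transpose) +
          Matrix.vecMulVec ((1 / 2 : 𝕜) • (eigenMatrixCoe 𝕜 n).mulVec (e₁ 𝕜 n + δe).ofLp)
            ((eigenMatrixCoe 𝕜 n).mulVec (coeffVec p + δc).ofLp))).det := by
  set U := eigenMatrixCoe 𝕜 n
  have hU : U * U.transpose = 1 := eigenMatrixCoe_mul_transpose 𝕜 n
  have hdet : U.det * U.transpose.det = 1 := by rw [← Matrix.det_mul, hU, Matrix.det_one]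
  have hrank : ∀ u v : Fin n → 𝕜, U * Matrix.vecMulVec u v * U.transpose =
      Matrix.vecMulVec (U.mulVec u) (U.mulVec v) := fun u v => by
    rw [Matrix.mul_vecMulVec, Matrix.vecMulVec_mul, Matrix.vecMul_transpose]
  rw [Matrix.eval_charpoly]
  calc _ = (U * (Matrix.scalar (Fin n) x - perturbedColleague p δH δe δc) * U.transpose).det := by
        rw [Matrix.det_mul, Matrix.det_mul, mul_right_comm, hdet, one_mul]
    _ = _ := by
        congr 1
        rw [perturbedColleague, Matrix.mul_sub, Matrix.sub_mul, Matrix.mul_sub, Matrix.sub_mul,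
          Matrix.mul_add, Matrix.add_mul, eigenMatrixCoe_mul_basisMatrix_mul_transpose 𝕜 hn,
          Matrix.mul_smul, Matrix.smul_mul, hrank, Matrix.smul_vecMulVec,
          ← (Matrix.scalar_commute x (fun r => Commute.all _ _) U).eq, Matrix.mul_assoc, hU, mul_one,
          Matrix.scalar_apply, ← Matrix.diagonal_sub]
        abel

theorem eval_ofReal_T (m : ℤ) (x : ℝ) :
    (Chebyshev.T 𝕜 m).eval (x : 𝕜) = (((Chebyshev.T ℝ m).eval x : ℝ) : 𝕜) := by
  rw [← Chebyshev.map_T (algebraMap ℝ 𝕜)]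
  exact eval_map_apply _ _

/-- The `√2` in `coeffVec` cancels the weight of `T_0`, and `T_n` contributes nothing at its own
zeros. -/
theorem eigenMatrixCoe_mulVec_coeffVec (q : EuclideanSpace 𝕜 (Fin n)) (k : Fin n) :
    (eigenMatrixCoe 𝕜 n).mulVec (coeffVec q).ofLp k =
      ((√(2 / n) : ℝ) : 𝕜) * (chebPoly q).eval ((node k : ℝ) : 𝕜) := by
  rw [chebPoly, eval_add, eval_ofReal_T, node, Chebyshev.T_real_cos, Int.cast_natCast,
    cos_natCast_mul_angle, RCLike.ofReal_zero, zero_add, eval_finsetSum, Finset.mul_sum,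
    Matrix.mulVec, dotProduct, ← Equiv.sum_comp Fin.revPerm]
  refine Finset.sum_congr rfl fun i _ => ?_
  rw [eval_mul, eval_C, eval_ofReal_T, Chebyshev.T_real_cos, Int.cast_natCast]
  simp only [eigenMatrixCoe, eigenMatrix, Matrix.map_apply, Matrix.of_apply, coeffVec, eigenWeight,
    Fin.revPerm_apply, Fin.rev_rev]
  split_ifs
  · have h2 : ((√2 : ℝ) : 𝕜) ≠ 0 := by
      rw [RCLike.ofReal_ne_zero]
      positivity
    simp only [RCLike.ofReal_mul, RCLike.ofReal_inv]
    field_simp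
  · simp only [RCLike.ofReal_mul, RCLike.ofReal_one]
    ring

theorem coeffVec_surjective : Function.Surjective (coeffVec : EuclideanSpace 𝕜 (Fin n) → _) := by
  intro c
  refine ⟨WithLp.toLp 2 fun j =>
    (if (j.rev : ℕ) + 1 = n then ((√2 : ℝ) : 𝕜) else 1)⁻¹ * c j.rev, ?_⟩
  ext i
  have h2 : (if (i : ℕ) + 1 = n then ((√2 : ℝ) : 𝕜) else 1) ≠ 0 := by
    split_ifs
    · rw [RCLike.ofReal_ne_zero]
      positivity
    · exact one_ne_zero
  simp only [coeffVec, Fin.rev_rev]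
  rw [mul_inv_cancel_left₀ h2]

theorem degree_chebPoly_sub_lt (q : EuclideanSpace 𝕜 (Fin n))
    (A : Matrix (Fin n) (Fin n) 𝕜) :
    (chebPoly q - C ((2 : 𝕜) ^ (n - 1)) * A.charpoly).degree < n := by
  have h2 : (2 : 𝕜) ^ (n - 1) ≠ 0 := pow_ne_zero _ two_ne_zero
  have hT : (Chebyshev.T 𝕜 (n : ℤ)).degree = n := by simp
  have hA : (C ((2 : 𝕜) ^ (n - 1)) * A.charpoly).degree = n := by
    rw [degree_C_mul h2, A.charpoly_degree_eq_dim, Fintype.card_fin]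
  rw [chebPoly, add_sub_right_comm]
  refine (degree_add_le _ _).trans_lt (max_lt ?_ ?_)
  · refine (degree_sub_lt_left (hT.trans hA.symm) (Chebyshev.T_ne_zero 𝕜 _) ?_).trans_eq hT
    rw [leadingCoeff_mul, leadingCoeff_C, A.charpoly_monic.leadingCoeff, mul_one,
      Chebyshev.leadingCoeff_T, Int.natAbs_natCast]
  · refine (degree_sum_le _ _).trans_lt ((Finset.sup_lt_iff (by exact WithBot.bot_lt_coe n)).2 ?_)
    intro j _
    refine (degree_mul_le _ _).trans_lt ?_
    refine (add_le_add degree_C_le le_rfl).trans_lt ?_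
    rw [Chebyshev.degree_T, zero_add, Int.natAbs_natCast]
    exact_mod_cast j.isLt

/-- Inverting `U` yields the `q` with prescribed values at the `n` nodes. Both polynomials have
leading coefficient `2^(n-1)`, so their difference has degree below `n` and `n` roots. -/
theorem exists_chebPoly_eq_charpoly (hn : n ≠ 0) (A : Matrix (Fin n) (Fin n) 𝕜) :
    ∃ q : EuclideanSpace 𝕜 (Fin n), chebPoly q = C ((2 : 𝕜) ^ (n - 1)) * A.charpoly := by
  have hs : ((√(2 / n) : ℝ) : 𝕜) ≠ 0 := by
    rw [RCLike.ofReal_ne_zero]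
    positivity
  obtain ⟨q, hq⟩ := coeffVec_surjective (WithLp.toLp 2 ((eigenMatrixCoe 𝕜 n).transpose.mulVec
    fun k => ((√(2 / n) : ℝ) : 𝕜) * (C ((2 : 𝕜) ^ (n - 1)) * A.charpoly).eval ((node k : ℝ) : 𝕜)))
  refine ⟨q, sub_eq_zero.1 (eq_zero_of_degree_lt_of_eval_finset_eq_zero
    (Finset.univ.image fun k : Fin n => ((node k : ℝ) : 𝕜)) ?_ ?_)⟩
  · rw [Finset.card_image_of_injective _ fun a b h => node_injective (RCLike.ofReal_injective h),
      Finset.card_univ, Fintype.card_fin]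
    exact degree_chebPoly_sub_lt q A
  · intro x hx
    obtain ⟨k, -, rfl⟩ := Finset.mem_image.1 hx
    have h := eigenMatrixCoe_mulVec_coeffVec q k
    rw [hq, Matrix.mulVec_mulVec, eigenMatrixCoe_mul_transpose, Matrix.one_mulVec] at h
    rw [eval_sub, mul_left_cancel₀ hs h, sub_self]

theorem eigenMatrixCoe_mulVec_e₁ (hn : 2 ≤ n) (k : Fin n) :
    (eigenMatrixCoe 𝕜 n).mulVec (e₁ 𝕜 n).ofLp k =
      ((√(2 / n) * (sin (n * angle k) * sin (angle k)) : ℝ) : 𝕜) := by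
  have he : (e₁ 𝕜 n).ofLp = Pi.single ⟨0, by omega⟩ 1 := by
    ext i
    simp [e₁, Pi.single_apply, Fin.ext_iff]
  have hcast : (((⟨0, by omega⟩ : Fin n).rev : ℕ) : ℝ) = n - 1 := by
    rw [Fin.val_rev, Nat.cast_sub (by simp; omega)]
    simp
  rw [he, Matrix.mulVec_single_one]
  simp only [Matrix.col_apply, eigenMatrixCoe, Matrix.map_apply, eigenMatrix, Matrix.of_apply, hcast,
    eigenWeight]
  -- `cos((n-1)θ) = sin nθ sin θ`, because `cos nθ = 0` at the nodes.
  rw [if_neg (by omega), sub_mul, one_mul, cos_sub, cos_natCast_mul_angle, RCLike.algebraMap_eq_ofReal]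
  simp

end Eigenvectors

/-! ### First order expansion of the determinant. -/

section Perturbation

theorem sum_mul_le_mul_of_sum_sq_le {ι : Type*} (s : Finset ι) (f g : ι → ℝ) {x y : ℝ} (hx : 0 ≤ x) (hy : 0 ≤ y)
    (hf : ∑ i ∈ s, f i ^ 2 ≤ x ^ 2) (hg : ∑ i ∈ s, g i ^ 2 ≤ y ^ 2) :
    ∑ i ∈ s, f i * g i ≤ x * y := by
  refine (Real.sum_mul_le_sqrt_mul_sqrt s f g).trans ?_
  exact mul_le_mul (Real.sqrt_le_iff.2 ⟨hx, hf⟩) (Real.sqrt_le_iff.2 ⟨hy, hg⟩) (Real.sqrt_nonneg _) hx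

variable {𝕜 ι : Type*} [RCLike 𝕜] [Fintype ι] [DecidableEq ι]

/-- The part of first order in `(E, a, β)`, up to the factor `∏ b ≠ k, d b`, of the determinant of
`diagonal d - E + ½ (e + a) (c + β)ᵀ`, where `d k = 0`. -/
noncomputable def firstOrderTerm (d : ι → 𝕜) (E : Matrix ι ι 𝕜) (e a c β : ι → 𝕜) (k : ι) : 𝕜 :=
  -E k k + 1 / 2 * (e k * β k) + 1 / 2 * (a k * c k) +
    ∑ b ∈ {k}ᶜ, 1 / 2 * (d b)⁻¹ * (-(E k k * (e b * c b)) - E b b * (e k * c k) +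
      E k b * (e b * c k) + E b k * (e k * c b))

theorem norm_mul_sub_mul_le {e a c β : 𝕜} {C ε₁ εc : ℝ} (he : ‖e‖ ≤ 1) (ha : ‖a‖ ≤ ε₁)
    (hc : ‖c‖ ≤ C) (hβ : ‖β‖ ≤ εc) :
    ‖(e + a) * (c + β) - e * c‖ ≤ ε₁ * C + εc + ε₁ * εc := by
  have hC := (norm_nonneg _).trans hc
  have h1 := (norm_nonneg _).trans ha
  calc ‖(e + a) * (c + β) - e * c‖ = ‖a * c + e * β + a * β‖ := by congr 1; ring
    _ ≤ ‖a‖ * ‖c‖ + ‖e‖ * ‖β‖ + ‖a‖ * ‖β‖ := by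
        simpa only [norm_mul] using norm_add₃_le (a := a * c) (b := e * β) (c := a * β)
    _ ≤ ε₁ * C + 1 * εc + ε₁ * εc := by gcongr
    _ = _ := by ring

/-- The error is at most linear in `C`, and `εc` enters only linearly; the relative bound `εc = a C
u` then yields no `C²`. -/
theorem exists_norm_det_sub_firstOrderTerm_le (ι : Type*) [Fintype ι] [DecidableEq ι] {B : ℝ}
    (hB : 1 ≤ B) :
    ∃ K : ℝ, 0 ≤ K ∧ ∀ (d : ι → 𝕜) (E : Matrix ι ι 𝕜) (e a c β : ι → 𝕜) (k : ι) (ε ε₁ εc C : ℝ),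
      d k = 0 → (∀ b, b ≠ k → d b ≠ 0) → (∀ b, ‖d b‖ ≤ 2) → ε ≤ B → (∀ i j, ‖E i j‖ ≤ ε) →
      (∀ i, ‖e i‖ ≤ 1) → (∀ i, ‖a i‖ ≤ ε₁) → (∀ i, ‖c i‖ ≤ C) → (∀ i, ‖β i‖ ≤ εc) →
      ‖(Matrix.diagonal d + (-E + Matrix.vecMulVec ((1 / 2 : 𝕜) • (e + a)) (c + β))).det -
        (∏ b ∈ {k}ᶜ, d b) * (1 / 2 * (e k * c k) + firstOrderTerm d E e a c β k)‖ ≤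
      K * (ε ^ 2 + ε ^ 2 * C + ε * ε₁ * C + ε * εc + ε₁ * εc) := by
  set m := Fintype.card ι
  -- One summand for each piece of the remainder: the set `{k}`, the pairs, and the sets with at
  -- least three elements.
  refine ⟨2 ^ m + m * (2 ^ m * (6 + 2 * B)) +
    2 ^ m * (2 ^ m * (2 ^ m * m.factorial * B ^ m * B ^ 2)), by positivity, ?_⟩
  intro d E e a c β k ε ε₁ εc C hdk hd hd2 hεB hE he ha hc hβ
  have hε : 0 ≤ ε := (norm_nonneg _).trans (hE k k)
  have hε₁ : 0 ≤ ε₁ := (norm_nonneg _).trans (ha k)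
  have hεc : 0 ≤ εc := (norm_nonneg _).trans (hβ k)
  have hC : 0 ≤ C := (norm_nonneg _).trans (hc k)
  set Q := ε ^ 2 + ε ^ 2 * C + ε * ε₁ * C + ε * εc + ε₁ * εc with hQ
  have hQ1 : ε ^ 2 ≤ Q := by
    have : 0 ≤ ε ^ 2 * C + ε * ε₁ * C + ε * εc + ε₁ * εc := by positivity
    linarith
  have hQ2 : ε * ε₁ * C ≤ Q := by
    have : 0 ≤ ε ^ 2 + ε ^ 2 * C + ε * εc + ε₁ * εc := by positivity
    linarith
  have hQ3 : ε * εc ≤ Q := by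
    have : 0 ≤ ε ^ 2 + ε ^ 2 * C + ε * ε₁ * C + ε₁ * εc := by positivity
    linarith
  have hQ4 : ε₁ * εc ≤ Q := by
    have : 0 ≤ ε ^ 2 + ε ^ 2 * C + ε * ε₁ * C + ε * εc := by positivity
    linarith
  have hprod : ∀ s : Finset ι, ‖∏ i ∈ s, d i‖ ≤ 2 ^ m := fun s => by
    rw [norm_prod]
    calc ∏ i ∈ s, ‖d i‖ ≤ ∏ _i ∈ s, (2 : ℝ) :=
          Finset.prod_le_prod (fun _ _ => norm_nonneg _) fun i _ => hd2 i
      _ = 2 ^ s.card := by rw [Finset.prod_const]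
      _ ≤ 2 ^ m := pow_le_pow_right₀ one_le_two (Finset.card_le_univ s)
  set M := -E + Matrix.vecMulVec ((1 / 2 : 𝕜) • (e + a)) (c + β) with hM
  have hMij : ∀ i j, M i j = -E i j + 1 / 2 * ((e i + a i) * (c j + β j)) := fun i j => by
    simp [hM, Matrix.vecMulVec_apply]
    ring
  have hpair : ∀ b ∈ ({k}ᶜ : Finset ι), ∏ i ∈ {k}ᶜ, d i = d b * ∏ i ∈ {k, b}ᶜ, d i := fun b hb => by
    have : ({k, b}ᶜ : Finset ι) = ({k}ᶜ : Finset ι).erase b := by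
      ext i
      simp
      tauto
    rw [this, Finset.mul_prod_erase _ _ hb]
  -- What is left of the minor on `{k, b}` without its first order part. Products of two rank-one
  -- entries have cancelled, so every term contains an entry of `E` and a second small factor.
  set T : ι → 𝕜 := fun b => E k k * E b b - E k b * E b k + 1 / 2 * (
      -(E k k * ((e b + a b) * (c b + β b) - e b * c b)) -
      E b b * ((e k + a k) * (c k + β k) - e k * c k) +
      E k b * ((e b + a b) * (c k + β k) - e b * c k) +
      E b k * ((e k + a k) * (c b + β b) - e k * c b)) with hT
  have hdecomp : (Matrix.diagonal d + M).det -
        (∏ b ∈ {k}ᶜ, d b) * (1 / 2 * (e k * c k) + firstOrderTerm d E e a c β k) =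
      (∏ b ∈ {k}ᶜ, d b) * (1 / 2 * (a k * β k)) +
        ∑ b ∈ {k}ᶜ, (∏ i ∈ {k, b}ᶜ, d i) * T b +
        ∑ s : Finset ι with 3 ≤ s.card, (∏ i ∈ sᶜ, d i) * M.principalMinor s := by
    have hsum : ∑ b ∈ {k}ᶜ, (∏ i ∈ {k, b}ᶜ, d i) * (M k k * M b b - M k b * M b k) =
        ∑ b ∈ {k}ᶜ, (∏ i ∈ {k, b}ᶜ, d i) * T b +
        (∏ b ∈ {k}ᶜ, d b) * ∑ b ∈ {k}ᶜ, 1 / 2 * (d b)⁻¹ * (-(E k k * (e b * c b)) -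
          E b b * (e k * c k) + E k b * (e b * c k) + E b k * (e k * c b)) := by
      rw [Finset.mul_sum, ← Finset.sum_add_distrib]
      refine Finset.sum_congr rfl fun b hb => ?_
      have hdb : d b ≠ 0 := hd b (by simpa using hb)
      rw [hpair b hb, hMij, hMij, hMij, hMij, hT]
      field_simp
      ring
    rw [Matrix.det_diagonal_add_of_apply_eq_zero d M hdk, hsum, hMij, firstOrderTerm]
    ring
  have hTle : ∀ b, ‖T b‖ ≤ (6 + 2 * B) * Q := by
    intro b
    have hp : ∀ i j, ‖(e i + a i) * (c j + β j) - e i * c j‖ ≤ ε₁ * C + εc + ε₁ * εc := fun i j =>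
      norm_mul_sub_mul_le (he i) (ha i) (hc j) (hβ j)
    set P := ε₁ * C + εc + ε₁ * εc with hP
    have hP0 : 0 ≤ P := by positivity
    have hmul : ∀ i j i' j', ‖E i j * ((e i' + a i') * (c j' + β j') - e i' * c j')‖ ≤ ε * P :=
      fun i j i' j' => by
        rw [norm_mul]
        exact mul_le_mul (hE i j) (hp i' j') (norm_nonneg _) hε
    have hmulE : ∀ i j i' j', ‖E i j * E i' j'‖ ≤ ε ^ 2 := fun i j i' j' => by
      rw [norm_mul, sq]
      exact mul_le_mul (hE i j) (hE i' j') (norm_nonneg _) hε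
    have h1 : ‖T b‖ ≤ ε ^ 2 + ε ^ 2 + 1 / 2 * (ε * P + ε * P + ε * P + ε * P) := by
      rw [hT]
      refine (norm_add_le _ _).trans (add_le_add ((norm_sub_le _ _).trans
        (add_le_add (hmulE ..) (hmulE ..))) ?_)
      rw [norm_mul]
      refine mul_le_mul (by simp) ?_ (norm_nonneg _) (by norm_num)
      refine (norm_add_le _ _).trans (add_le_add ((norm_add_le _ _).trans (add_le_add
        ((norm_sub_le _ _).trans (add_le_add ?_ ?_)) ?_)) ?_)
      · rw [norm_neg]
        exact hmul ..
      all_goals exact hmul ..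
    have h2 : ε * P ≤ Q + Q + B * Q := by
      have : ε * (ε₁ * εc) ≤ B * Q := mul_le_mul hεB hQ4 (by positivity) (by positivity)
      rw [hP]
      nlinarith
    nlinarith
  have hminor : ∀ s : Finset ι, 3 ≤ s.card →
      ‖M.principalMinor s‖ ≤ 2 ^ m * m.factorial * B ^ m * B ^ 2 * Q := by
    intro s hs
    have hUle : ∀ i j, ‖((1 / 2 : 𝕜) • (e + a)) i * (c + β) j‖ ≤ (1 + ε₁) * (C + εc) := by
      intro i j
      simp only [Pi.smul_apply, Pi.add_apply, smul_eq_mul, norm_mul]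
      have h1 : ‖(1 / 2 : 𝕜)‖ ≤ 1 := by
        rw [norm_div, norm_one, RCLike.norm_ofNat]
        norm_num
      have h2 : ‖e i + a i‖ ≤ 1 + ε₁ := (norm_add_le _ _).trans (add_le_add (he i) (ha i))
      have h3 : ‖c j + β j‖ ≤ C + εc := (norm_add_le _ _).trans (add_le_add (hc j) (hβ j))
      calc ‖(1 / 2 : 𝕜)‖ * ‖e i + a i‖ * ‖c j + β j‖ ≤ 1 * (1 + ε₁) * (C + εc) := by gcongr
        _ = _ := by ring
    have hsub : M.submatrix (Subtype.val : s → ι) (Subtype.val : s → ι) =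
        -E.submatrix Subtype.val Subtype.val + Matrix.vecMulVec
          (fun i : s => ((1 / 2 : 𝕜) • (e + a)) i) (fun j : s => (c + β) j) := by
      ext i j
      rfl
    have hcard : Fintype.card s = s.card := Fintype.card_coe s
    have hsm : s.card ≤ m := Finset.card_le_univ s
    have h := Matrix.norm_det_add_vecMulVec_le (-E.submatrix (Subtype.val : s → ι) Subtype.val)
      (fun i : s => ((1 / 2 : 𝕜) • (e + a)) i) (fun j : s => (c + β) j) (by omega) hB hεB
      (fun i j => by simpa using hE i j) (fun i j => hUle i j)
    rw [← hsub, hcard] at h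
    have hfin : ε ^ 2 * (1 + (1 + ε₁) * (C + εc)) ≤ B ^ 2 * Q := by
      have hB2 : 0 ≤ B ^ 2 - 1 := by nlinarith
      have hBB : B ≤ B ^ 2 := by nlinarith
      have hsq : ε ^ 2 ≤ B ^ 2 := by gcongr
      have h1 : ε ^ 2 * (ε₁ * C) ≤ B ^ 2 * (ε * ε₁ * C) := by
        have : ε * (ε * (ε₁ * C)) ≤ B ^ 2 * (ε * (ε₁ * C)) := by
          gcongr
          linarith
        linarith
      have h2 : ε ^ 2 * εc ≤ B ^ 2 * (ε * εc) := by
        have : ε * (ε * εc) ≤ B ^ 2 * (ε * εc) := by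
          gcongr
          linarith
        linarith
      have h3 : ε ^ 2 * (ε₁ * εc) ≤ B ^ 2 * (ε₁ * εc) := by gcongr
      have h4 : 0 ≤ (B ^ 2 - 1) * (ε ^ 2 + ε ^ 2 * C) := by positivity
      rw [hQ]
      nlinarith
    calc ‖M.principalMinor s‖ ≤ 2 ^ s.card * s.card.factorial * B ^ s.card *
            (ε ^ 2 * (1 + (1 + ε₁) * (C + εc))) := h
      _ ≤ 2 ^ m * m.factorial * B ^ m * (B ^ 2 * Q) := by
          have := Nat.factorial_le hsm
          have h2 : (2 : ℝ) ^ s.card ≤ 2 ^ m := pow_le_pow_right₀ one_le_two hsm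
          have h3 : B ^ s.card ≤ B ^ m := pow_le_pow_right₀ hB hsm
          have h4 : (s.card.factorial : ℝ) ≤ m.factorial := by exact_mod_cast this
          gcongr
      _ = _ := by ring
  have hQ0 : 0 ≤ Q := (sq_nonneg ε).trans hQ1
  rw [hdecomp]
  have t1 : ‖(∏ b ∈ {k}ᶜ, d b) * (1 / 2 * (a k * β k))‖ ≤ 2 ^ m * Q := by
    rw [norm_mul]
    refine mul_le_mul (hprod _) ?_ (norm_nonneg _) (by positivity)
    rw [norm_mul, norm_mul]
    have : ‖a k‖ * ‖β k‖ ≤ ε₁ * εc := mul_le_mul (ha k) (hβ k) (norm_nonneg _) hε₁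
    have h1 : ‖(1 / 2 : 𝕜)‖ ≤ 1 := by
      rw [norm_div, norm_one, RCLike.norm_ofNat]
      norm_num
    calc _ ≤ 1 * (ε₁ * εc) := by gcongr
      _ ≤ Q := by linarith
  have t2 : ‖∑ b ∈ {k}ᶜ, (∏ i ∈ {k, b}ᶜ, d i) * T b‖ ≤ m * (2 ^ m * ((6 + 2 * B) * Q)) := by
    refine (norm_sum_le _ _).trans ((Finset.sum_le_card_nsmul _ _ (2 ^ m * ((6 + 2 * B) * Q))
      fun b _ => ?_).trans ?_)
    · rw [norm_mul]
      exact mul_le_mul (hprod _) (hTle b) (norm_nonneg _) (by positivity)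
    · rw [nsmul_eq_mul]
      have : ((({k}ᶜ : Finset ι).card : ℕ) : ℝ) ≤ m := by exact_mod_cast Finset.card_le_univ _
      gcongr
  have t3 : ‖∑ s : Finset ι with 3 ≤ s.card, (∏ i ∈ sᶜ, d i) * M.principalMinor s‖ ≤
      2 ^ m * (2 ^ m * (2 ^ m * m.factorial * B ^ m * B ^ 2 * Q)) := by
    refine (norm_sum_le _ _).trans ((Finset.sum_le_card_nsmul _ _
      (2 ^ m * (2 ^ m * m.factorial * B ^ m * B ^ 2 * Q)) fun s hs => ?_).trans ?_)
    · rw [norm_mul]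
      exact mul_le_mul (hprod _) (hminor s (Finset.mem_filter.1 hs).2) (norm_nonneg _)
        (by positivity)
    · rw [nsmul_eq_mul]
      have : (((Finset.univ.filter fun s : Finset ι => 3 ≤ s.card).card : ℕ) : ℝ) ≤ 2 ^ m := by
        refine le_trans (Nat.cast_le.2 (Finset.card_le_univ _)) ?_
        rw [Fintype.card_finset]
        push_cast
        rfl
      gcongr
  refine (norm_add₃_le ..).trans ?_
  calc _ ≤ _ := add_le_add (add_le_add t1 t2) t3
    _ = _ := by ring

end Perturbation

/-! ### Bounding the first order term. -/

section FirstOrder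

variable {𝕜 ι : Type*} [RCLike 𝕜] [Fintype ι] [DecidableEq ι]

theorem norm_firstOrderTerm_le (d : ι → 𝕜) (E : Matrix ι ι 𝕜) (e a c β : ι → 𝕜) (k : ι) :
    ‖firstOrderTerm d E e a c β k‖ ≤ ‖E k k‖ + 1 / 2 * (‖e k‖ * ‖β k‖) + 1 / 2 * (‖a k‖ * ‖c k‖) +
      1 / 2 * (‖E k k‖ * ∑ b ∈ {k}ᶜ, ‖d b‖⁻¹ * ‖e b‖ * ‖c b‖ +
        ‖e k‖ * ‖c k‖ * ∑ b ∈ {k}ᶜ, ‖d b‖⁻¹ * ‖E b b‖ +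
        ‖c k‖ * ∑ b ∈ {k}ᶜ, ‖d b‖⁻¹ * ‖e b‖ * ‖E k b‖ +
        ‖e k‖ * ∑ b ∈ {k}ᶜ, ‖d b‖⁻¹ * ‖E b k‖ * ‖c b‖) := by
  have h2 : ‖(1 / 2 : 𝕜)‖ = 1 / 2 := by rw [norm_div, norm_one, RCLike.norm_ofNat]
  have hterm : ∀ b, ‖1 / 2 * (d b)⁻¹ * (-(E k k * (e b * c b)) - E b b * (e k * c k) +
      E k b * (e b * c k) + E b k * (e k * c b))‖ ≤
      1 / 2 * (‖E k k‖ * (‖d b‖⁻¹ * ‖e b‖ * ‖c b‖) + ‖e k‖ * ‖c k‖ * (‖d b‖⁻¹ * ‖E b b‖) +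
        ‖c k‖ * (‖d b‖⁻¹ * ‖e b‖ * ‖E k b‖) + ‖e k‖ * (‖d b‖⁻¹ * ‖E b k‖ * ‖c b‖)) := by
    intro b
    rw [norm_mul, norm_mul, h2, norm_inv]
    have h : ‖-(E k k * (e b * c b)) - E b b * (e k * c k) +
        E k b * (e b * c k) + E b k * (e k * c b)‖ ≤ ‖E k k‖ * (‖e b‖ * ‖c b‖) +
        ‖E b b‖ * (‖e k‖ * ‖c k‖) + ‖E k b‖ * (‖e b‖ * ‖c k‖) + ‖E b k‖ * (‖e k‖ * ‖c b‖) := by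
      refine (norm_add_le _ _).trans (add_le_add ((norm_add_le _ _).trans (add_le_add
        ((norm_sub_le _ _).trans (add_le_add ?_ ?_)) ?_)) ?_) <;> simp
    calc _ ≤ 1 / 2 * ‖d b‖⁻¹ * (‖E k k‖ * (‖e b‖ * ‖c b‖) +
        ‖E b b‖ * (‖e k‖ * ‖c k‖) + ‖E k b‖ * (‖e b‖ * ‖c k‖) + ‖E b k‖ * (‖e k‖ * ‖c b‖)) := by
          gcongr
      _ = _ := by ring
  rw [firstOrderTerm]
  refine (norm_add_le _ _).trans (add_le_add ((norm_add₃_le ..).trans (add_le_add (add_le_add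
    (norm_neg _).le ?_) ?_)) ?_)
  · rw [norm_mul, norm_mul, h2]
  · rw [norm_mul, norm_mul, h2]
  · refine (norm_sum_le _ _).trans ((Finset.sum_le_sum fun b _ => hterm b).trans_eq ?_)
    simp only [Finset.mul_sum, ← Finset.sum_add_distrib]

/-- Here `σ b` stands for `sin θ_b`, `r b` for `1/|k - b|`, `s` for `√(2/n)`, and `N / σ k` is the
size of `2^(n-1) ∏ d b`. The norms of `c k`, `a k`, `β k` are kept separate so that they can later
be summed over `k`. -/
theorem norm_firstOrderTerm_le_of_bounds (d : ι → 𝕜) (E : Matrix ι ι 𝕜) (e a c β : ι → 𝕜) (k : ι)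
    {σ r : ι → ℝ} {N s ε C : ℝ} (hN : 0 < N) (hs : 0 ≤ s) (hε : 0 ≤ ε) (hC : 0 ≤ C)
    (hcard : (Fintype.card ι : ℝ) ≤ N)
    (hσ : ∀ b, N⁻¹ ≤ σ b) (he : ∀ b, ‖e b‖ = s * σ b) (hr0 : ∀ b, 0 ≤ r b)
    (hr : ∑ b ∈ {k}ᶜ, r b ^ 2 ≤ 4) (hd : ∀ b ∈ ({k}ᶜ : Finset ι), ‖d b‖⁻¹ * σ b ≤ N * r b)
    (hE : ∀ i j, ‖E i j‖ ≤ ε) (hErow : ∑ b, ‖E k b‖ ^ 2 ≤ ε ^ 2) (hEcol : ∑ b, ‖E b k‖ ^ 2 ≤ ε ^ 2)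
    (hc : ∑ b, ‖c b‖ ^ 2 ≤ C ^ 2) :
    N / σ k * ‖firstOrderTerm d E e a c β k‖ ≤ N ^ 2 * ε + 1 / 2 * N * s * ‖β k‖ +
      1 / 2 * N ^ 2 * (‖a k‖ * ‖c k‖) + 2 * N ^ 3 * s * ε * C +
      N ^ 3 * s * ε * (√N + 1) * ‖c k‖ := by
  have hσ0 : ∀ b, 0 < σ b := fun b => (inv_pos.2 hN).trans_le (hσ b)
  have hNσ : N / σ k ≤ N ^ 2 := by
    rw [div_le_iff₀ (hσ0 k)]
    have := mul_le_mul_of_nonneg_left (hσ k) (sq_nonneg N)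
    rwa [sq, mul_assoc, mul_inv_cancel₀ hN.ne', mul_one, ← sq] at this
  -- Terms containing `e k` carry their own `σ k`, so they cost only `N`; the others cost `N ^ 2`.
  have hNs : ∀ x : ℝ, N / σ k * (s * σ k * x) = N * s * x := fun x => by
    have := (hσ0 k).ne'
    field_simp
  have hd' : ∀ b ∈ ({k}ᶜ : Finset ι), ‖d b‖⁻¹ ≤ N ^ 2 * r b := fun b hb => by
    have h1 : ‖d b‖⁻¹ * N⁻¹ ≤ N * r b :=
      (mul_le_mul_of_nonneg_left (hσ b) (by positivity)).trans (hd b hb)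
    rw [← div_eq_mul_inv, div_le_iff₀ hN] at h1
    linarith
  have hde : ∀ b ∈ ({k}ᶜ : Finset ι), ‖d b‖⁻¹ * ‖e b‖ ≤ s * N * r b := fun b hb => by
    rw [he]
    nlinarith [mul_le_mul_of_nonneg_left (hd b hb) hs]
  have hsub : ∀ f : ι → ℝ, ∑ b ∈ {k}ᶜ, f b ^ 2 ≤ ∑ b, f b ^ 2 := fun f =>
    Finset.sum_le_sum_of_subset_of_nonneg (Finset.subset_univ _) fun _ _ _ => sq_nonneg _
  have hr' : ∑ b ∈ {k}ᶜ, r b ^ 2 ≤ 2 ^ 2 := hr.trans_eq (by norm_num)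
  have s1 : ∑ b ∈ {k}ᶜ, ‖d b‖⁻¹ * ‖e b‖ * ‖c b‖ ≤ s * N * (2 * C) := by
    calc _ ≤ ∑ b ∈ {k}ᶜ, s * N * (r b * ‖c b‖) := Finset.sum_le_sum fun b hb => by
          rw [← mul_assoc]
          exact mul_le_mul_of_nonneg_right (hde b hb) (norm_nonneg _)
      _ ≤ _ := by
          rw [← Finset.mul_sum]
          gcongr
          exact sum_mul_le_mul_of_sum_sq_le _ _ _ zero_le_two hC hr' ((hsub _).trans hc)
  have s2 : ∑ b ∈ {k}ᶜ, ‖d b‖⁻¹ * ‖E b b‖ ≤ N ^ 2 * ε * (2 * √N) := by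
    calc _ ≤ ∑ b ∈ {k}ᶜ, N ^ 2 * ε * (r b * 1) := Finset.sum_le_sum fun b hb => by
          have := mul_le_mul (hd' b hb) (hE b b) (norm_nonneg _)
            (mul_nonneg (sq_nonneg N) (hr0 b))
          linarith
      _ ≤ _ := by
          rw [← Finset.mul_sum]
          gcongr
          refine sum_mul_le_mul_of_sum_sq_le _ r (fun _ => 1) zero_le_two (Real.sqrt_nonneg _) hr'
            ((hsub _).trans ?_)
          rw [Real.sq_sqrt hN.le]
          simpa using hcard
  have s3 : ∑ b ∈ {k}ᶜ, ‖d b‖⁻¹ * ‖e b‖ * ‖E k b‖ ≤ s * N * (2 * ε) := by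
    calc _ ≤ ∑ b ∈ {k}ᶜ, s * N * (r b * ‖E k b‖) := Finset.sum_le_sum fun b hb => by
          rw [← mul_assoc]
          exact mul_le_mul_of_nonneg_right (hde b hb) (norm_nonneg _)
      _ ≤ _ := by
          rw [← Finset.mul_sum]
          gcongr
          exact sum_mul_le_mul_of_sum_sq_le _ _ _ zero_le_two hε hr' ((hsub _).trans hErow)
  -- Cauchy–Schwarz is spent on the column of `E` and on `c`, so `r` is only bounded pointwise, by
  -- `2`.
  have s4 : ∑ b ∈ {k}ᶜ, ‖d b‖⁻¹ * ‖E b k‖ * ‖c b‖ ≤ N ^ 2 * 2 * (ε * C) := by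
    calc _ ≤ ∑ b ∈ {k}ᶜ, N ^ 2 * 2 * (‖E b k‖ * ‖c b‖) := Finset.sum_le_sum fun b hb => by
          have hr2 : r b ≤ 2 := by
            have := (Finset.single_le_sum (f := fun b => r b ^ 2) (fun _ _ => sq_nonneg _) hb).trans hr
            nlinarith [hr0 b]
          have h1 : ‖d b‖⁻¹ ≤ N ^ 2 * 2 := (hd' b hb).trans (by gcongr)
          rw [mul_assoc]
          gcongr
      _ ≤ _ := by
          rw [← Finset.mul_sum]
          gcongr
          exact sum_mul_le_mul_of_sum_sq_le _ _ _ hε hC ((hsub _).trans hEcol) ((hsub _).trans hc)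
  have hNk : 0 ≤ N / σ k := by have := hσ0 k; positivity
  have hck := norm_nonneg (c k)
  have hsum := norm_firstOrderTerm_le d E e a c β k
  have hb1 : ‖E k k‖ * ∑ b ∈ {k}ᶜ, ‖d b‖⁻¹ * ‖e b‖ * ‖c b‖ ≤ ε * (s * N * (2 * C)) :=
    mul_le_mul (hE k k) s1 (Finset.sum_nonneg fun _ _ => by positivity) hε
  have key : ‖firstOrderTerm d E e a c β k‖ ≤ (ε + 1 / 2 * (‖a k‖ * ‖c k‖) + s * N * ε * C +
      s * N * ε * ‖c k‖) + s * σ k * (1 / 2 * ‖β k‖ + N ^ 2 * ε * √N * ‖c k‖ + N ^ 2 * ε * C) := by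
    have e1 : ‖e k‖ * ‖c k‖ * ∑ b ∈ {k}ᶜ, ‖d b‖⁻¹ * ‖E b b‖ ≤
        s * σ k * ‖c k‖ * (N ^ 2 * ε * (2 * √N)) := by
      rw [← he]
      gcongr
    have e2 : ‖e k‖ * ∑ b ∈ {k}ᶜ, ‖d b‖⁻¹ * ‖E b k‖ * ‖c b‖ ≤
        s * σ k * (N ^ 2 * 2 * (ε * C)) := by
      rw [← he]
      gcongr
    have e3 := mul_le_mul_of_nonneg_left s3 hck
    have e4 := hE k k
    rw [he k] at hsum
    rw [he k] at e1 e2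
    linarith
  calc N / σ k * ‖firstOrderTerm d E e a c β k‖ ≤ _ := mul_le_mul_of_nonneg_left key hNk
    _ = N / σ k * (ε + 1 / 2 * (‖a k‖ * ‖c k‖) + s * N * ε * C + s * N * ε * ‖c k‖) +
        N * s * (1 / 2 * ‖β k‖ + N ^ 2 * ε * √N * ‖c k‖ + N ^ 2 * ε * C) := by
      rw [mul_add, hNs]
    _ ≤ N ^ 2 * (ε + 1 / 2 * (‖a k‖ * ‖c k‖) + s * N * ε * C + s * N * ε * ‖c k‖) +
        N * s * (1 / 2 * ‖β k‖ + N ^ 2 * ε * √N * ‖c k‖ + N ^ 2 * ε * C) := by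
      gcongr
    _ = _ := by ring

end FirstOrder

/-! ### From values at the nodes back to coefficients. -/

section CoefficientBound

variable {n : ℕ} {𝕜 : Type*} [RCLike 𝕜]

theorem sum_norm_sq_col_le (E : Matrix (Fin n) (Fin n) 𝕜) (k : Fin n) :
    ∑ b, ‖E b k‖ ^ 2 ≤ ‖E‖ ^ 2 := by
  have h := Matrix.l2_opNorm_mulVec E (EuclideanSpace.single k (1 : 𝕜))
  rw [PiLp.norm_single, norm_one, mul_one] at h
  have h2 := pow_le_pow_left₀ (norm_nonneg _) h 2
  rw [EuclideanSpace.norm_sq_eq] at h2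
  refine le_trans (Finset.sum_le_sum fun b _ => ?_) h2
  simp

theorem sum_norm_sq_row_le (E : Matrix (Fin n) (Fin n) 𝕜) (k : Fin n) :
    ∑ b, ‖E k b‖ ^ 2 ≤ ‖E‖ ^ 2 := by
  have h := sum_norm_sq_col_le E.conjTranspose k
  rw [Matrix.l2_opNorm_conjTranspose] at h
  simpa [Matrix.conjTranspose_apply] using h

theorem norm_entry_le (E : Matrix (Fin n) (Fin n) 𝕜) (i j : Fin n) : ‖E i j‖ ≤ ‖E‖ :=
  le_of_sq_le_sq ((Finset.single_le_sum (f := fun b => ‖E b j‖ ^ 2)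
    (fun _ _ => sq_nonneg _) (Finset.mem_univ i)).trans (sum_norm_sq_col_le E j)) (norm_nonneg _)

theorem coeffVec_add (p q : EuclideanSpace 𝕜 (Fin n)) :
    coeffVec (p + q) = coeffVec p + coeffVec q := by
  ext i
  simp [coeffVec, mul_add]

theorem norm_apply_le_norm_coeffVec_apply (q : EuclideanSpace 𝕜 (Fin n)) (j : Fin n) :
    ‖q j‖ ≤ ‖coeffVec q j.rev‖ := by
  simp only [coeffVec, Fin.rev_rev, norm_mul]
  refine le_mul_of_one_le_left (norm_nonneg _) ?_
  split_ifs
  · rw [RCLike.norm_ofReal, abs_of_nonneg (Real.sqrt_nonneg _)]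
    exact Real.one_le_sqrt.2 one_le_two
  · rw [norm_one]

theorem norm_coeffVec_le (q : EuclideanSpace 𝕜 (Fin n)) : ‖coeffVec q‖ ≤ √2 * ‖q‖ := by
  refine le_of_sq_le_sq ?_ (by positivity)
  rw [mul_pow, Real.sq_sqrt zero_le_two, EuclideanSpace.norm_sq_eq, EuclideanSpace.norm_sq_eq,
    Finset.mul_sum, ← Equiv.sum_comp Fin.revPerm]
  refine Finset.sum_le_sum fun j _ => ?_
  simp only [coeffVec, Fin.revPerm_apply, Fin.rev_rev, norm_mul, mul_pow]
  gcongr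
  split_ifs
  · rw [RCLike.norm_ofReal, sq_abs, Real.sq_sqrt zero_le_two]
  · norm_num

theorem norm_apply_le_sum_norm_mulVec (c : EuclideanSpace 𝕜 (Fin n)) (i : Fin n) :
    ‖c i‖ ≤ √(2 / n) * ∑ k, ‖(eigenMatrixCoe 𝕜 n).mulVec c.ofLp k‖ := by
  have h : c.ofLp = (eigenMatrixCoe 𝕜 n).transpose.mulVec ((eigenMatrixCoe 𝕜 n).mulVec c.ofLp) := by
    rw [Matrix.mulVec_mulVec, eigenMatrixCoe_transpose_mul_self, Matrix.one_mulVec]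
  have hentry : ∀ k, ‖eigenMatrixCoe 𝕜 n k i‖ ≤ √(2 / n) := fun k => by
    simp only [eigenMatrixCoe, eigenMatrix, Matrix.map_apply, Matrix.of_apply, norm_algebraMap',
      norm_mul, Real.norm_eq_abs]
    have h1 : |eigenWeight i| ≤ 1 := by
      unfold eigenWeight
      split_ifs
      · rw [abs_inv, abs_of_nonneg (Real.sqrt_nonneg _)]
        exact inv_le_one_of_one_le₀ (Real.one_le_sqrt.2 one_le_two)
      · rw [abs_one]
    rw [abs_of_nonneg (Real.sqrt_nonneg _)]
    exact mul_le_of_le_one_right (Real.sqrt_nonneg _)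
      (mul_le_one₀ h1 (abs_nonneg _) (Real.abs_cos_le_one _))
  conv_lhs => rw [h]
  rw [Matrix.mulVec, dotProduct, Finset.mul_sum]
  refine (norm_sum_le _ _).trans (Finset.sum_le_sum fun k _ => ?_)
  rw [norm_mul, Matrix.transpose_apply]
  exact mul_le_mul_of_nonneg_right (hentry k) (norm_nonneg _)

theorem sum_norm_sq_eigenMatrixCoe_mulVec_le (v : EuclideanSpace 𝕜 (Fin n)) {x : ℝ} (h : ‖v‖ ≤ x) :
    ∑ k, ‖(eigenMatrixCoe 𝕜 n).mulVec v.ofLp k‖ ^ 2 ≤ x ^ 2 := by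
  have := pow_le_pow_left₀ (norm_nonneg _) ((norm_eigenMatrixCoe_mulVec_le 𝕜 v).trans h) 2
  rwa [EuclideanSpace.norm_sq_eq] at this

/-- Second order terms are bounded by a multiple of this quantity. -/
def secondOrderBound (C ε ε₁ εc : ℝ) : ℝ :=
  ε ^ 2 + ε ^ 2 * C + ε * ε₁ * C + ε * εc + ε₁ * εc

theorem exists_norm_mulVec_coeffVec_le (hn : 2 ≤ n) {B : ℝ} (hB : 1 ≤ B) :
    ∃ K : ℝ, 0 ≤ K ∧ ∀ (p δp : EuclideanSpace 𝕜 (Fin n)) (δH : Matrix (Fin n) (Fin n) 𝕜)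
      (δe δc : EuclideanSpace 𝕜 (Fin n)) (ε ε₁ εc : ℝ),
      ‖δH‖ ≤ ε → ε ≤ B → ‖δe‖ ≤ ε₁ → ‖δc‖ ≤ εc →
      chebPoly (p + δp) = C ((2 : 𝕜) ^ (n - 1)) * (perturbedColleague p δH δe δc).charpoly →
      ∀ k, ‖(eigenMatrixCoe 𝕜 n).mulVec (coeffVec δp).ofLp k‖ ≤ √(2 / n) *
        (n ^ 2 * ε + 1 / 2 * n * √(2 / n) * ‖(eigenMatrixCoe 𝕜 n).mulVec δc.ofLp k‖ +
        1 / 2 * n ^ 2 * (‖(eigenMatrixCoe 𝕜 n).mulVec δe.ofLp k‖ *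
          ‖(eigenMatrixCoe 𝕜 n).mulVec (coeffVec p).ofLp k‖) +
        2 * n ^ 3 * √(2 / n) * ε * ‖coeffVec p‖ +
        n ^ 3 * √(2 / n) * ε * (√n + 1) * ‖(eigenMatrixCoe 𝕜 n).mulVec (coeffVec p).ofLp k‖ +
        K * secondOrderBound ‖coeffVec p‖ ε ε₁ εc) := by
  obtain ⟨K, hK, hdet⟩ := exists_norm_det_sub_firstOrderTerm_le (𝕜 := 𝕜) (Fin n) hB
  refine ⟨2 ^ (n - 1) * K, by positivity, ?_⟩
  intro p δp δH δe δc ε ε₁ εc hδH hεB hδe hδc hp k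
  have hn0 : (0 : ℝ) < n := by positivity
  set U := eigenMatrixCoe 𝕜 n with hU
  set s : ℝ := √(2 / n) with hs
  have hs2 : s ^ 2 * n = 2 := by
    rw [hs, Real.sq_sqrt (by positivity)]
    field_simp
  have hs0 : 0 ≤ s := Real.sqrt_nonneg _
  set d : Fin n → 𝕜 := fun b => ((node k : ℝ) : 𝕜) - ((node b : ℝ) : 𝕜) with hd
  set E := U * δH * U.transpose with hEdef
  set e := U.mulVec (e₁ 𝕜 n).ofLp with hedef
  set a := U.mulVec δe.ofLp with hadef
  set c := U.mulVec (coeffVec p).ofLp with hcdef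
  set β := U.mulVec δc.ofLp with hβdef
  have hd_real : ∀ b, d b = ((node k - node b : ℝ) : 𝕜) := fun b => by
    rw [hd]
    push_cast
    rfl
  have hd_norm : ∀ b, ‖d b‖ = |node k - node b| := fun b => by
    rw [hd_real, RCLike.norm_ofReal]
  have hE : ‖E‖ ≤ ε := (norm_eigenMatrixCoe_conj_le 𝕜 δH).trans hδH
  have hε : 0 ≤ ε := (norm_nonneg _).trans hδH
  have happ : ∀ (v : EuclideanSpace 𝕜 (Fin n)) (x : ℝ), ‖v‖ ≤ x → ∀ i, ‖U.mulVec v.ofLp i‖ ≤ x :=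
    fun v x hv i => le_of_sq_le_sq ((Finset.single_le_sum (f := fun i => ‖U.mulVec v.ofLp i‖ ^ 2)
      (fun _ _ => sq_nonneg _) (Finset.mem_univ i)).trans
      (sum_norm_sq_eigenMatrixCoe_mulVec_le v hv)) ((norm_nonneg _).trans hv)
  have hsin : ∀ b : Fin n, |Real.sin (n * angle b)| = 1 := fun b => by
    rw [← abs_one, ← sq_eq_sq_iff_abs_eq_abs, one_pow]
    exact sin_natCast_mul_angle_sq b
  have he : ∀ b, ‖e b‖ = s * Real.sin (angle b) := fun b => by
    rw [hedef, eigenMatrixCoe_mulVec_e₁ hn, RCLike.norm_ofReal, abs_mul, abs_mul, hsin,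
      abs_of_nonneg hs0, abs_of_pos (sin_angle_pos b), one_mul]
  have he1 : ∀ b, ‖e b‖ ≤ 1 := happ (e₁ 𝕜 n) 1 (by
    have : e₁ 𝕜 n = EuclideanSpace.single ⟨0, by omega⟩ 1 := by
      ext i
      simp [e₁, Fin.ext_iff]
    rw [this, PiLp.norm_single, norm_one])
  set g : 𝕜 := ∏ b ∈ {k}ᶜ, d b with hg
  have hg_real : g = ((∏ b ∈ {k}ᶜ, (node k - node b) : ℝ) : 𝕜) := by
    rw [hg, RCLike.ofReal_prod]
    exact Finset.prod_congr rfl fun b _ => hd_real b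
  have hprod := prod_node_sub_node k
  have hsk := sin_angle_pos k
  have hg_norm : ‖(2 : 𝕜) ^ (n - 1) * g‖ = n / Real.sin (angle k) := by
    rw [eq_div_iff hsk.ne', hg_real, norm_mul, norm_pow, RCLike.norm_ofNat, RCLike.norm_ofReal]
    have := congrArg abs hprod
    rwa [abs_mul, abs_mul, abs_mul, abs_pow, abs_two, hsin, abs_of_pos hsk, Nat.abs_cast, mul_one]
      at this
  -- The term of order zero reproduces exactly `(U (coeffVec p)) k`; it cancels, leaving the
  -- contribution of `δp`.
  have hge : (s : 𝕜) * (2 ^ (n - 1) * g * (1 / 2 * (e k * c k))) = c k := by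
    have h1 : (s : 𝕜) * (2 ^ (n - 1) * g * e k) = 2 := by
      rw [hg_real, hedef, eigenMatrixCoe_mulVec_e₁ hn, ← hs]
      have : s * (2 ^ (n - 1) * (∏ b ∈ {k}ᶜ, (node k - node b)) *
          (s * (Real.sin (n * angle k) * Real.sin (angle k)))) = 2 := by
        have h3 := sin_natCast_mul_angle_sq k
        calc _ = s ^ 2 * Real.sin (n * angle k) * (2 ^ (n - 1) *
              (∏ b ∈ {k}ᶜ, (node k - node b)) * Real.sin (angle k)) := by ring
          _ = s ^ 2 * n * Real.sin (n * angle k) ^ 2 := by rw [hprod]; ring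
          _ = 2 := by rw [h3, hs2, mul_one]
      have h4 := congrArg (fun x : ℝ => (x : 𝕜)) this
      push_cast at h4 ⊢
      exact h4
    calc _ = 1 / 2 * ((s : 𝕜) * (2 ^ (n - 1) * g * e k)) * c k := by ring
      _ = c k := by rw [h1]; ring
  have hdetk := hdet d E e a c β k ε ε₁ εc ‖coeffVec p‖ (sub_self _)
    (fun b hb => sub_ne_zero.2 fun h => hb (node_injective (RCLike.ofReal_injective h)).symm)
    (fun b => (hd_norm b).trans_le (abs_node_sub_node_le k b)) hεB
    (fun i j => (norm_entry_le E i j).trans hE) he1 (happ δe ε₁ hδe) (happ (coeffVec p) _ le_rfl)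
    (happ δc εc hδc)
  have hlin := norm_firstOrderTerm_le_of_bounds d E e a c β k (σ := fun b => Real.sin (angle b))
    (r := fun b => |((k : ℕ) : ℝ) - (b : ℕ)|⁻¹) hn0 hs0 hε (norm_nonneg (coeffVec p)) (by simp)
    inv_le_sin_angle he (fun b => by positivity) (sum_inv_sq_sub_le k)
    (fun b hb => by
      have hbk : b ≠ k := by simpa using hb
      have h0 : 0 < |node k - node b| :=
        abs_pos.2 (sub_ne_zero.2 fun h => hbk (node_injective h).symm)
      have h1 : 0 < |((k : ℕ) : ℝ) - (b : ℕ)| :=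
        abs_pos.2 (sub_ne_zero.2 fun h => hbk (Fin.ext (by exact_mod_cast h.symm)))
      have := sin_angle_mul_abs_sub_le k b
      rw [hd_norm, inv_mul_le_iff₀ h0, ← div_eq_mul_inv, mul_div_assoc', le_div_iff₀ h1]
      linarith)
    (fun i j => (norm_entry_le E i j).trans hE)
    ((sum_norm_sq_row_le E k).trans (pow_le_pow_left₀ (norm_nonneg _) hE 2))
    ((sum_norm_sq_col_le E k).trans (pow_le_pow_left₀ (norm_nonneg _) hE 2))
    (sum_norm_sq_eigenMatrixCoe_mulVec_le (coeffVec p) le_rfl)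
  have hval : U.mulVec (coeffVec δp).ofLp k = (s : 𝕜) * (2 ^ (n - 1) *
      ((Matrix.diagonal d + (-E + Matrix.vecMulVec ((1 / 2 : 𝕜) • (e + a)) (c + β))).det -
        g * (1 / 2 * (e k * c k) + firstOrderTerm d E e a c β k)) +
      2 ^ (n - 1) * g * firstOrderTerm d E e a c β k) := by
    have h1 := eigenMatrixCoe_mulVec_coeffVec (p + δp) k
    rw [hp, eval_mul, eval_C, eval_charpoly_perturbedColleague hn, coeffVec_add, WithLp.ofLp_add,
      WithLp.ofLp_add, WithLp.ofLp_add, Matrix.mulVec_add, Matrix.mulVec_add, Matrix.mulVec_add,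
      Pi.add_apply] at h1
    change c k + _ = (s : 𝕜) * (2 ^ (n - 1) * (Matrix.diagonal d +
      (-E + Matrix.vecMulVec ((1 / 2 : 𝕜) • (e + a)) (c + β))).det) at h1
    linear_combination h1 + hge
  rw [hval, norm_mul, RCLike.norm_ofReal, abs_of_nonneg hs0]
  refine mul_le_mul_of_nonneg_left ?_ hs0
  refine (norm_add_le _ _).trans ?_
  rw [add_comm, norm_mul (_ * g), hg_norm]
  refine add_le_add hlin ?_
  rw [norm_mul, norm_pow, RCLike.norm_ofNat, mul_assoc]
  exact mul_le_mul_of_nonneg_left hdetk (by positivity)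

/-- Each coefficient is at most `√(2/n)` times the sum over `k` of the nodal bounds. Summation uses
Cauchy–Schwarz and the fact that `U` does not increase norms. -/
theorem exists_norm_apply_le (hn : 2 ≤ n) {B : ℝ} (hB : 1 ≤ B) :
    ∃ K : ℝ, 0 ≤ K ∧ ∀ (p δp : EuclideanSpace 𝕜 (Fin n)) (δH : Matrix (Fin n) (Fin n) 𝕜)
      (δe δc : EuclideanSpace 𝕜 (Fin n)) (ε ε₁ εc : ℝ),
      ‖δH‖ ≤ ε → ε ≤ B → ‖δe‖ ≤ ε₁ → ‖δc‖ ≤ εc →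
      chebPoly (p + δp) = C ((2 : 𝕜) ^ (n - 1)) * (perturbedColleague p δH δe δc).charpoly →
      ∀ j, ‖δp j‖ ≤ (6 * ‖coeffVec p‖ * ε₁ + 2 * √n * εc + (5 + 16 * √n * ‖coeffVec p‖) * ε) *
        (n : ℝ) ^ 2 + K * secondOrderBound ‖coeffVec p‖ ε ε₁ εc := by
  obtain ⟨K, hK, hbound⟩ := exists_norm_mulVec_coeffVec_le (𝕜 := 𝕜) hn hB
  refine ⟨2 * K, by positivity, ?_⟩
  intro p δp δH δe δc ε ε₁ εc hδH hεB hδe hδc hp j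
  have hε : 0 ≤ ε := (norm_nonneg _).trans hδH
  have hε₁ : 0 ≤ ε₁ := (norm_nonneg _).trans hδe
  have hεc : 0 ≤ εc := (norm_nonneg _).trans hδc
  have hC := norm_nonneg (coeffVec p)
  set U := eigenMatrixCoe 𝕜 n
  set C := ‖coeffVec p‖
  set Q := secondOrderBound C ε ε₁ εc
  have hn1 : (1 : ℝ) ≤ n := by exact_mod_cast (by omega : 1 ≤ n)
  set N : ℝ := (n : ℝ)
  set s : ℝ := √(2 / N) with hs
  set w := √N with hw
  have hw2 : w ^ 2 = N := Real.sq_sqrt (by linarith)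
  have hw1 : 1 ≤ w := Real.one_le_sqrt.2 hn1
  have hs0 : 0 ≤ s := Real.sqrt_nonneg _
  have hsw : s * w = √2 := by
    rw [hs, hw, ← Real.sqrt_mul (by positivity), div_mul_cancel₀ _ (by positivity)]
  have hs2 : s * s * N = 2 := by
    rw [← hw2]
    have := congrArg (· ^ 2) hsw
    simp only [mul_pow, Real.sq_sqrt zero_le_two] at this
    linarith
  have hcs : ∀ (v : EuclideanSpace 𝕜 (Fin n)) (x : ℝ), ‖v‖ ≤ x → 0 ≤ x →
      ∑ k, ‖U.mulVec v.ofLp k‖ ≤ w * x := fun v x hv hx => by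
    have := sum_mul_le_mul_of_sum_sq_le Finset.univ (fun _ : Fin n => (1 : ℝ))
      (fun k => ‖U.mulVec v.ofLp k‖) (x := w) (by positivity) hx (by simp [hw2, N])
      (sum_norm_sq_eigenMatrixCoe_mulVec_le v hv)
    simpa using this
  have h1 := hcs δc εc hδc hεc
  have h2 : ∑ k, ‖U.mulVec δe.ofLp k‖ * ‖U.mulVec (coeffVec p).ofLp k‖ ≤ ε₁ * C :=
    sum_mul_le_mul_of_sum_sq_le _ _ _ hε₁ hC (sum_norm_sq_eigenMatrixCoe_mulVec_le δe hδe)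
      (sum_norm_sq_eigenMatrixCoe_mulVec_le (coeffVec p) le_rfl)
  have h3 := hcs (coeffVec p) C le_rfl hC
  have hsum : ‖δp j‖ ≤ s * ∑ k, s * (N ^ 2 * ε + 1 / 2 * N * s * ‖U.mulVec δc.ofLp k‖ +
      1 / 2 * N ^ 2 * (‖U.mulVec δe.ofLp k‖ * ‖U.mulVec (coeffVec p).ofLp k‖) +
      2 * N ^ 3 * s * ε * C + N ^ 3 * s * ε * (w + 1) * ‖U.mulVec (coeffVec p).ofLp k‖ +
      K * Q) := by
    refine (norm_apply_le_norm_coeffVec_apply δp j).trans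
      ((norm_apply_le_sum_norm_mulVec (coeffVec δp) j.rev).trans ?_)
    exact mul_le_mul_of_nonneg_left (Finset.sum_le_sum fun k _ =>
      hbound p δp δH δe δc ε ε₁ εc hδH hεB hδe hδc hp k) hs0
  rw [← Finset.mul_sum] at hsum
  simp only [Finset.sum_add_distrib, ← Finset.mul_sum, Finset.sum_const, Finset.card_univ,
    Fintype.card_fin, nsmul_eq_mul] at hsum
  have hsq2 : √2 ≤ 2 := Real.sqrt_le_iff.2 ⟨zero_le_two, by norm_num⟩
  have hNw : N ≤ N ^ 2 := by nlinarith
  calc ‖δp j‖ ≤ s * (s * (N ^ 2 * (N * ε) + 1 / 2 * N * s * (w * εc) +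
        1 / 2 * N ^ 2 * (ε₁ * C) + 2 * N ^ 3 * s * ε * (N * C) +
        N ^ 3 * s * ε * (w + 1) * (w * C) + K * (N * Q))) := by
        refine hsum.trans ?_
        gcongr
    _ = 2 * N ^ 2 * ε + s * w * εc + N * ε₁ * C + 4 * N ^ 2 * (s * w) * w * ε * C +
        2 * N ^ 2 * (s * w) * (w + 1) * ε * C + 2 * K * Q := by
        rw [← hw2] at hs2 ⊢
        linear_combination (w ^ 4 * ε + 1 / 2 * s * w * εc + 1 / 2 * w ^ 2 * ε₁ * C +
          2 * w ^ 6 * s * ε * C + w ^ 4 * s * ε * (w + 1) * w * C + K * Q) * hs2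
    -- Only `√2 ≤ 2`, `1 ≤ √n` and `1 ≤ n` are used; the constants `5`, `2` and `6` leave slack.
    _ ≤ 5 * N ^ 2 * ε + 2 * w * N ^ 2 * εc + 6 * N ^ 2 * ε₁ * C + 16 * w * C * ε * N ^ 2 +
        2 * K * Q := by
        rw [hsw]
        have i1 : 0 ≤ N ^ 2 * ε := by positivity
        have i2 : √2 * εc ≤ 2 * w * N ^ 2 * εc := by
          have : 2 * 1 * 1 ≤ 2 * w * N ^ 2 := by gcongr; exact one_le_pow₀ hn1
          have := mul_le_mul_of_nonneg_right this hεc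
          nlinarith
        have i3 : N * ε₁ * C ≤ 6 * N ^ 2 * ε₁ * C := by
          gcongr
          linarith
        have i4 : 4 * N ^ 2 * √2 * w * ε * C + 2 * N ^ 2 * √2 * (w + 1) * ε * C ≤
            16 * w * C * ε * N ^ 2 := by
          have h4 : 4 * 2 * w + 2 * 2 * (w + 1) ≤ 16 * w := by linarith
          calc _ ≤ 4 * N ^ 2 * 2 * w * ε * C + 2 * N ^ 2 * 2 * (w + 1) * ε * C := by gcongr
            _ = N ^ 2 * ε * C * (4 * 2 * w + 2 * 2 * (w + 1)) := by ring
            _ ≤ N ^ 2 * ε * C * (16 * w) := by gcongr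
            _ = _ := by ring
        linarith
    _ = _ := by ring

end CoefficientBound

/-! ### Diagonal form from a unit minor. -/

section SmithForm

variable {R : Type*} [CommRing R]

/-- Move row `a` and column `b` to the front and eliminate with the invertible block `D`; the corner
becomes the Schur complement. -/
theorem exists_isUnit_mul_mul_eq_diagonal_of_isUnit_det_submatrix {m : ℕ}
    (M : Matrix (Fin (m + 1)) (Fin (m + 1)) R) (a b : Fin (m + 1))
    (h : IsUnit (M.submatrix a.succAbove b.succAbove).det) :
    ∃ E F : Matrix (Fin (m + 1)) (Fin (m + 1)) R, IsUnit E ∧ IsUnit F ∧ ∃ q : R,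
      E * M * F = Matrix.diagonal fun i : Fin (m + 1) => if (i : ℕ) = 0 then q else 1 := by
  let σ : Fin (m + 1) → (Unit ⊕ Fin m ≃ Fin (m + 1)) := fun a =>
    ((Equiv.sumComm _ _).trans (Equiv.optionEquivSumPUnit (Fin m)).symm).trans
      (finSuccEquiv' a).symm
  have hσl : ∀ a, σ a (Sum.inl ()) = a := fun a => by simp [σ]
  have hσr : ∀ a i, σ a (Sum.inr i) = a.succAbove i := fun a i => by simp [σ]
  set D := M.submatrix a.succAbove b.succAbove with hD
  set A : Matrix Unit Unit R := Matrix.of fun _ _ => M a b with hA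
  set u : Matrix Unit (Fin m) R := Matrix.of fun _ j => M a (b.succAbove j) with hu
  set v : Matrix (Fin m) Unit R := Matrix.of fun i _ => M (a.succAbove i) b with hv
  have hblock : M.submatrix (σ a) (σ b) = Matrix.fromBlocks A u v D := by
    ext (i | i) (j | j) <;> simp [hσl, hσr, hA, hu, hv, hD]
  have hDD : D⁻¹ * D = 1 := Matrix.nonsing_inv_mul D h
  have hDinv : IsUnit (D⁻¹).det := Matrix.isUnit_nonsing_inv_det D h
  set E₀ : Matrix (Unit ⊕ Fin m) (Unit ⊕ Fin m) R := Matrix.fromBlocks 1 (-(u * D⁻¹)) 0 D⁻¹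
  set F₀ : Matrix (Unit ⊕ Fin m) (Unit ⊕ Fin m) R := Matrix.fromBlocks 1 0 (-(D⁻¹ * v)) 1
  have hE₀ : IsUnit E₀ := by
    rw [Matrix.isUnit_iff_isUnit_det, Matrix.det_fromBlocks_zero₂₁, Matrix.det_one, one_mul]
    exact hDinv
  have hF₀ : IsUnit F₀ := by
    rw [Matrix.isUnit_iff_isUnit_det, Matrix.det_fromBlocks_zero₁₂, Matrix.det_one, Matrix.det_one,
      one_mul]
    exact isUnit_one
  have hprod : E₀ * M.submatrix (σ a) (σ b) * F₀ =
      Matrix.fromBlocks (A - u * D⁻¹ * v) 0 0 1 := by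
    rw [hblock, Matrix.fromBlocks_multiply, Matrix.fromBlocks_multiply]
    simp [Matrix.mul_assoc, hDD, sub_eq_add_neg]
  refine ⟨E₀.submatrix (σ 0).symm (σ a).symm, F₀.submatrix (σ b).symm (σ 0).symm,
    (Matrix.isUnit_submatrix_equiv _ _).2 hE₀, (Matrix.isUnit_submatrix_equiv _ _).2 hF₀,
    (A - u * D⁻¹ * v) () (), ?_⟩
  have hM : E₀.submatrix (σ 0).symm (σ a).symm * M * F₀.submatrix (σ b).symm (σ 0).symm =
      E₀.submatrix (σ 0).symm (σ a).symm * (M.submatrix (σ a) (σ b)).submatrix (σ a).symm (σ b).symm *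
        F₀.submatrix (σ b).symm (σ 0).symm := by
    simp
  rw [hM]
  rw [Matrix.submatrix_mul_equiv, Matrix.submatrix_mul_equiv, hprod]
  ext i j
  obtain ⟨i, rfl⟩ := (σ 0).surjective i
  obtain ⟨j, rfl⟩ := (σ 0).surjective j
  rw [Matrix.submatrix_apply, Equiv.symm_apply_apply, Equiv.symm_apply_apply]
  rcases i with i | i <;> rcases j with j | j <;>
    simp [hσl, hσr, Matrix.diagonal_apply, Matrix.one_apply,
      fun j : Fin m => (Fin.succ_ne_zero j).symm]

/-- Taking determinants shows that the corner is `M.det` up to a unit, which a diagonal factor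
adjusts to `w`. -/
theorem exists_isUnit_mul_mul_eq_diagonal_mul_det {m : ℕ}
    (M : Matrix (Fin (m + 1)) (Fin (m + 1)) R) (a b : Fin (m + 1))
    (h : IsUnit (M.submatrix a.succAbove b.succAbove).det) {w : R} (hw : IsUnit w) :
    ∃ E F : Matrix (Fin (m + 1)) (Fin (m + 1)) R, IsUnit E ∧ IsUnit F ∧
      E * M * F = Matrix.diagonal fun i : Fin (m + 1) => if (i : ℕ) = 0 then w * M.det else 1 := by
  obtain ⟨E, F, hE, hF, q, hq⟩ := exists_isUnit_mul_mul_eq_diagonal_of_isUnit_det_submatrix M a b h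
  have hdiag : ∀ x : R, (Matrix.diagonal fun i : Fin (m + 1) => if (i : ℕ) = 0 then x else 1).det = x :=
    fun x => by
      rw [Matrix.det_diagonal, Fin.prod_univ_succ]
      simp
  have hdet : E.det * M.det * F.det = q := by rw [← Matrix.det_mul, ← Matrix.det_mul, hq, hdiag]
  have hEu := (Matrix.isUnit_iff_isUnit_det E).1 hE
  have hFu := (Matrix.isUnit_iff_isUnit_det F).1 hF
  obtain ⟨z, hz⟩ := (hEu.mul hFu).exists_left_inv
  have hzu : IsUnit z := IsUnit.of_mul_eq_one _ hz
  refine ⟨(Matrix.diagonal fun i : Fin (m + 1) => if (i : ℕ) = 0 then w * z else 1) * E, F, ?_, hF, ?_⟩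
  · refine IsUnit.mul ?_ hE
    rw [Matrix.isUnit_iff_isUnit_det, hdiag]
    exact hw.mul hzu
  · rw [Matrix.mul_assoc, Matrix.mul_assoc, ← Matrix.mul_assoc E, hq, Matrix.diagonal_mul_diagonal]
    congr 1
    funext i
    split_ifs
    · rw [← hdet]
      linear_combination w * M.det * hz
    · rw [one_mul]

end SmithForm

/-! ### Cyclic vectors and strong linearization. -/

section StrongLinearization

variable {K : Type*} [Field K]

/-- The Krylov matrix with columns `v, A v, …, A ^ (n - 1) v`. -/
def krylovMatrix {n : ℕ} (A : Matrix (Fin n) (Fin n) K) (v : Fin n → K) : Matrix (Fin n) (Fin n) K :=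
  Matrix.of fun i j => ((A ^ (j : ℕ)).mulVec v) i

/-- `A` sends each Krylov column to the next, so in the Krylov basis it is a companion matrix: all
columns but the last are shifted unit vectors. -/
theorem exists_similar_of_isUnit_krylovMatrix {m : ℕ} (A : Matrix (Fin (m + 1)) (Fin (m + 1)) K)
    (v : Fin (m + 1) → K) (h : IsUnit (krylovMatrix A v)) :
    ∃ P B : Matrix (Fin (m + 1)) (Fin (m + 1)) K, IsUnit P ∧ A * P = P * B ∧
      ∀ i (j : Fin m), B i j.castSucc = if i = j.succ then 1 else 0 := by
  set P := krylovMatrix A v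
  have hdet := (Matrix.isUnit_iff_isUnit_det P).1 h
  refine ⟨P, P⁻¹ * (A * P), h, (Matrix.mul_nonsing_inv_cancel_left _ _ hdet).symm, fun i j => ?_⟩
  have hcol : (A * P).col j.castSucc = P.col j.succ := by
    ext i
    have : A.mulVec ((A ^ (j : ℕ)).mulVec v) = (A ^ ((j : ℕ) + 1)).mulVec v := by
      rw [Matrix.mulVec_mulVec, pow_succ']
    exact congrFun this i
  have : (P⁻¹ * (A * P)).col j.castSucc = Pi.single j.succ 1 := by
    rw [← Matrix.mulVec_single_one, ← Matrix.mulVec_mulVec, Matrix.mulVec_single_one, hcol,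
      ← Matrix.mulVec_single_one, Matrix.mulVec_mulVec, Matrix.nonsing_inv_mul P hdet,
      Matrix.one_mulVec]
  have := congrFun this i
  rw [Matrix.col_apply] at this
  rw [this, Pi.single_apply]

/-- Without the first row and last column, the pencil is upper triangular with `-1` on the diagonal.
-/
theorem isUnit_det_submatrix_X_sub {m : ℕ} (B : Matrix (Fin (m + 1)) (Fin (m + 1)) K)
    (hB : ∀ i (j : Fin m), B i j.castSucc = if i = j.succ then 1 else 0) :
    IsUnit (((X : K[X]) • (1 : Matrix (Fin (m + 1)) (Fin (m + 1)) K[X]) - B.map C).submatrix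
      (0 : Fin (m + 1)).succAbove (Fin.last m).succAbove).det := by
  rw [Matrix.det_of_isUpperTriangular]
  · refine IsUnit.prod_iff.2 fun i _ => ?_
    simp [hB, Fin.ext_iff]
  · intro i j hij
    have hij : j < i := hij
    have h2 : (i : ℕ) + 1 ≠ j := by have : (j : ℕ) < i := hij; omega
    simp [hB, Fin.ext_iff, h2]
    omega

/-- Without the last row and last column, the reversed pencil is lower triangular with `1` on the
diagonal. -/
theorem isUnit_det_submatrix_one_sub {m : ℕ} (B : Matrix (Fin (m + 1)) (Fin (m + 1)) K)
    (hB : ∀ i (j : Fin m), B i j.castSucc = if i = j.succ then 1 else 0) :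
    IsUnit (((1 : Matrix (Fin (m + 1)) (Fin (m + 1)) K[X]) - (X : K[X]) • B.map C).submatrix
      (Fin.last m).succAbove (Fin.last m).succAbove).det := by
  rw [Matrix.det_of_isLowerTriangular]
  · refine IsUnit.prod_iff.2 fun i _ => ?_
    simp [hB, Fin.ext_iff]
  · intro i j hij
    have hij : i < j := hij
    have h2 : (i : ℕ) ≠ j := by have : (i : ℕ) < j := hij; omega
    have h3 : (i : ℕ) ≠ j + 1 := by have : (i : ℕ) < j := hij; omega
    simp [hB, Fin.ext_iff, h2, h3]

theorem unimodularEquivDiag_of_mul_eq_mul {n : ℕ} {𝕜 : Type*} [RCLike 𝕜]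
    {L L' P : Matrix (Fin n) (Fin n) 𝕜[X]} {q : 𝕜[X]} (hP : IsUnit P) (hL : L * P = P * L')
    (h : UnimodularEquivDiag L' q) : UnimodularEquivDiag L q := by
  obtain ⟨E, F, hE, hF, h⟩ := h
  obtain ⟨u, rfl⟩ := hP
  refine ⟨E * (u⁻¹ : (Matrix (Fin n) (Fin n) 𝕜[X])ˣ), u * F, hE.mul (Units.isUnit _),
    (Units.isUnit _).mul hF, ?_⟩
  rw [← h]
  simp only [mul_assoc]
  rw [← mul_assoc L, hL, mul_assoc, Units.inv_mul_cancel_left]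

theorem isStrongLinearization_of_isUnit_krylovMatrix {n : ℕ} {𝕜 : Type*} [RCLike 𝕜] (hn : n ≠ 0)
    (A : Matrix (Fin n) (Fin n) 𝕜) (v : Fin n → 𝕜) (h : IsUnit (krylovMatrix A v)) {w : 𝕜}
    (hw : w ≠ 0) : IsStrongLinearization A (C w * A.charpoly) := by
  obtain ⟨m, rfl⟩ := Nat.exists_eq_succ_of_ne_zero hn
  obtain ⟨P, B, hP, hAP, hB⟩ := exists_similar_of_isUnit_krylovMatrix A v h
  have hwC : IsUnit (C w) := isUnit_C.2 (isUnit_iff_ne_zero.2 hw)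
  have hPC : IsUnit (P.map C) := hP.map (C : 𝕜 →+* 𝕜[X]).mapMatrix
  have hcomm : A.map C * P.map C = P.map C * B.map C := by
    rw [← Matrix.map_mul, hAP, Matrix.map_mul]
  have hdetP : IsUnit (P.map C).det := (Matrix.isUnit_iff_isUnit_det _).1 hPC
  have hdet : ∀ L L' : Matrix (Fin (m + 1)) (Fin (m + 1)) 𝕜[X], L * P.map C = P.map C * L' →
      L'.det = L.det := fun L L' hL => by
    have := congrArg Matrix.det hL
    rw [Matrix.det_mul, Matrix.det_mul, mul_comm] at this
    exact (hdetP.mul_left_cancel this).symm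
  constructor
  · have hL : ((X : 𝕜[X]) • (1 : Matrix (Fin (m + 1)) (Fin (m + 1)) 𝕜[X]) - A.map C) * P.map C =
        P.map C * ((X : 𝕜[X]) • (1 : Matrix (Fin (m + 1)) (Fin (m + 1)) 𝕜[X]) - B.map C) := by
      rw [sub_mul, mul_sub, hcomm, Matrix.smul_mul, Matrix.mul_smul, one_mul, mul_one]
    refine unimodularEquivDiag_of_mul_eq_mul hPC hL ?_
    have hchar : A.charpoly =
        ((X : 𝕜[X]) • (1 : Matrix (Fin (m + 1)) (Fin (m + 1)) 𝕜[X]) - A.map C).det := by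
      rw [Matrix.charpoly, Matrix.charmatrix, Matrix.smul_one_eq_diagonal]
      rfl
    rw [hchar, ← hdet _ _ hL]
    exact exists_isUnit_mul_mul_eq_diagonal_mul_det _ _ _ (isUnit_det_submatrix_X_sub B hB) hwC
  · have hL : ((1 : Matrix (Fin (m + 1)) (Fin (m + 1)) 𝕜[X]) - (X : 𝕜[X]) • A.map C) * P.map C =
        P.map C * ((1 : Matrix (Fin (m + 1)) (Fin (m + 1)) 𝕜[X]) - (X : 𝕜[X]) • B.map C) := by
      rw [sub_mul, mul_sub, Matrix.smul_mul, Matrix.mul_smul, hcomm, one_mul, mul_one]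
    refine unimodularEquivDiag_of_mul_eq_mul hPC hL ?_
    have hchar : (C w * A.charpoly).reflect (m + 1) = C w *
        ((1 : Matrix (Fin (m + 1)) (Fin (m + 1)) 𝕜[X]) - (X : 𝕜[X]) • A.map C).det := by
      have hdeg : A.charpoly.natDegree = m + 1 := by
        rw [A.charpoly_natDegree_eq_dim, Fintype.card_fin]
      have hrev := A.reverse_charpoly
      rw [reverse, hdeg] at hrev
      rw [reflect_C_mul, hrev, Matrix.charpolyRev]
    rw [hchar, ← hdet _ _ hL]
    exact exists_isUnit_mul_mul_eq_diagonal_mul_det _ _ _ (isUnit_det_submatrix_one_sub B hB) hwC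

/-- Each application of a Hessenberg matrix pushes the last nonzero entry down by one place, so the
Krylov matrix is triangular with nonzero diagonal. -/
theorem isUnit_krylovMatrix_of_hessenberg {n : ℕ} (A : Matrix (Fin n) (Fin n) K) (v : Fin n → K)
    (hzero : ∀ i j : Fin n, (j : ℕ) + 1 < i → A i j = 0)
    (hne : ∀ i j : Fin n, (j : ℕ) + 1 = i → A i j ≠ 0)
    (hv : ∀ i : Fin n, 0 < (i : ℕ) → v i = 0) (hv0 : ∀ i : Fin n, (i : ℕ) = 0 → v i ≠ 0) :
    IsUnit (krylovMatrix A v) := by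
  have key : ∀ l : ℕ, (∀ i : Fin n, l < i → ((A ^ l).mulVec v) i = 0) ∧
      ∀ i : Fin n, (i : ℕ) = l → ((A ^ l).mulVec v) i ≠ 0 := by
    intro l
    induction l with
    | zero => simpa using ⟨hv, hv0⟩
    | succ l ih =>
      rw [pow_succ', ← Matrix.mulVec_mulVec]
      refine ⟨fun i hi => ?_, fun i hi => ?_⟩
      · rw [Matrix.mulVec, dotProduct]
        refine Finset.sum_eq_zero fun j _ => ?_
        rcases lt_or_ge l (j : ℕ) with hj | hj
        · rw [ih.1 j hj, mul_zero]
        · rw [hzero i j (by omega), zero_mul]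
      · have hl : l < n := by omega
        rw [Matrix.mulVec, dotProduct, Finset.sum_eq_single ⟨l, hl⟩ (fun j _ hj => ?_) (by simp)]
        · exact mul_ne_zero (hne i _ hi.symm) (ih.2 _ rfl)
        · have hjl : (j : ℕ) ≠ l := fun h => hj (Fin.ext h)
          rcases lt_or_ge l (j : ℕ) with hj | hj
          · rw [ih.1 j hj, mul_zero]
          · rw [hzero i j (by omega), zero_mul]
  rw [Matrix.isUnit_iff_isUnit_det, Matrix.det_of_isUpperTriangular]
  · exact isUnit_iff_ne_zero.2 (Finset.prod_ne_zero_iff.2 fun i _ => (key i).2 i rfl)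
  · intro i j hij
    exact (key j).1 i hij

/-- The rank-one term only alters the first row, so the subdiagonal part is that of `H`. -/
theorem isUnit_krylovMatrix_colleague {n : ℕ} {𝕜 : Type*} [RCLike 𝕜] (p : EuclideanSpace 𝕜 (Fin n)) :
    IsUnit (krylovMatrix (perturbedColleague p 0 0 0) (e₁ 𝕜 n).ofLp) := by
  have hentry : ∀ i j : Fin n, (j : ℕ) < i →
      perturbedColleague p 0 0 0 i j = basisMatrix 𝕜 n i j := fun i j hij => by
    have : (i : ℕ) ≠ 0 := by omega
    simp [perturbedColleague, Matrix.vecMulVec_apply, e₁, this]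
  refine isUnit_krylovMatrix_of_hessenberg _ _ (fun i j hij => ?_) (fun i j hij => ?_)
    (fun i hi => ?_) (fun i hi => ?_)
  · rw [hentry i j (by omega), basisMatrix, Matrix.of_apply, if_neg (by omega)]
  · rw [hentry i j (by omega), basisMatrix, Matrix.of_apply, if_pos (Or.inr hij)]
    split_ifs
    · rw [RCLike.ofReal_ne_zero]
      positivity
    · simp
  · simp [e₁, hi.ne']
  · simp [e₁, hi]

/-- The Krylov determinant is continuous in the perturbation and nonzero at the origin, hence
nonzero on a ball. -/
theorem exists_isUnit_krylovMatrix_perturbedColleague {n : ℕ} {𝕜 : Type*} [RCLike 𝕜]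
    (p : EuclideanSpace 𝕜 (Fin n)) :
    ∃ r : ℝ, 0 < r ∧ ∀ (δH : Matrix (Fin n) (Fin n) 𝕜) (δe δc : EuclideanSpace 𝕜 (Fin n)),
      ‖δH‖ < r → ‖δe‖ < r → ‖δc‖ < r →
      IsUnit (krylovMatrix (perturbedColleague p δH δe δc) (e₁ 𝕜 n).ofLp) := by
  let f : Matrix (Fin n) (Fin n) 𝕜 × EuclideanSpace 𝕜 (Fin n) × EuclideanSpace 𝕜 (Fin n) → 𝕜 :=
    fun x => (krylovMatrix (perturbedColleague p x.1 x.2.1 x.2.2) (e₁ 𝕜 n).ofLp).det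
  have hA : Continuous fun x : Matrix (Fin n) (Fin n) 𝕜 × EuclideanSpace 𝕜 (Fin n) ×
      EuclideanSpace 𝕜 (Fin n) => perturbedColleague p x.1 x.2.1 x.2.2 := by
    have hv : Continuous fun x : Matrix (Fin n) (Fin n) 𝕜 × EuclideanSpace 𝕜 (Fin n) ×
        EuclideanSpace 𝕜 (Fin n) =>
        Matrix.vecMulVec (e₁ 𝕜 n + x.2.1).ofLp (coeffVec p + x.2.2).ofLp :=
      Continuous.matrix_vecMulVec
        ((PiLp.continuous_ofLp 2 _).comp
          (continuous_const.add (continuous_fst.comp continuous_snd)))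
        ((PiLp.continuous_ofLp 2 _).comp
          (continuous_const.add (continuous_snd.comp continuous_snd)))
    exact (continuous_const.add continuous_fst).sub (hv.const_smul (1 / 2 : 𝕜))
  have hf : Continuous f := by
    refine Continuous.matrix_det ?_
    refine continuous_matrix fun i j => ?_
    exact (continuous_apply i).comp ((hA.pow (j : ℕ)).matrix_mulVec continuous_const)
  have h0 : f 0 ≠ 0 :=
    isUnit_iff_ne_zero.1 ((Matrix.isUnit_iff_isUnit_det _).1 (isUnit_krylovMatrix_colleague p))
  obtain ⟨r, hr, hball⟩ := Metric.eventually_nhds_iff_ball.1 (hf.continuousAt.eventually_ne h0)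
  refine ⟨r, hr, fun δH δe δc h1 h2 h3 => ?_⟩
  have hx := hball (δH, δe, δc) (by
    rw [mem_ball_zero_iff, Prod.norm_def, Prod.norm_def]
    exact max_lt h1 (max_lt h2 h3))
  exact (Matrix.isUnit_iff_isUnit_det _).2 (isUnit_iff_ne_zero.2 hx)

end StrongLinearization

/-! ### Final estimates and the main theorem. -/

theorem secondOrderBound_le {C ε ε₁ εc : ℝ} (hC : 0 ≤ C) :
    secondOrderBound C ε ε₁ εc ≤ 2 * ((1 + C) * (ε ^ 2 + ε₁ ^ 2 + εc ^ 2)) := by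
  have h1 : ε ^ 2 + ε * ε₁ ≤ 2 * (ε ^ 2 + ε₁ ^ 2 + εc ^ 2) := by
    nlinarith [sq_nonneg (ε - ε₁), sq_nonneg εc, sq_nonneg ε₁]
  have h2 : ε ^ 2 + ε * εc + ε₁ * εc ≤ 2 * (ε ^ 2 + ε₁ ^ 2 + εc ^ 2) := by
    nlinarith [sq_nonneg (ε - εc), sq_nonneg (ε₁ - εc), sq_nonneg ε₁]
  have := mul_le_mul_of_nonneg_right h1 hC
  rw [secondOrderBound]
  linarith

theorem norm_le_sqrt_mul_of_forall_norm_apply_le {n : ℕ} {𝕜 : Type*} [RCLike 𝕜]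
    (v : EuclideanSpace 𝕜 (Fin n)) {b : ℝ} (hb : 0 ≤ b) (h : ∀ j, ‖v j‖ ≤ b) : ‖v‖ ≤ √n * b := by
  refine le_of_sq_le_sq ?_ (by positivity)
  rw [EuclideanSpace.norm_sq_eq, mul_pow, Real.sq_sqrt (Nat.cast_nonneg n)]
  refine (Finset.sum_le_sum fun j _ => pow_le_pow_left₀ (norm_nonneg _) (h j) 2).trans_eq ?_
  simp

theorem exists_add_chebPoly_eq_charpoly {n : ℕ} {𝕜 : Type*} [RCLike 𝕜] (hn : n ≠ 0)
    (p : EuclideanSpace 𝕜 (Fin n)) (A : Matrix (Fin n) (Fin n) 𝕜) :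
    ∃ δp : EuclideanSpace 𝕜 (Fin n),
      chebPoly (p + δp) = C ((2 : 𝕜) ^ (n - 1)) * A.charpoly := by
  obtain ⟨q, hq⟩ := exists_chebPoly_eq_charpoly hn A
  exact ⟨q - p, by rw [add_sub_cancel, hq]⟩

theorem exists_norm_le_of_relative_perturbation {n : ℕ} (𝕜 : Type*) [RCLike 𝕜] (hn : 2 ≤ n) {a : ℝ}
    (ha : 0 ≤ a) :
    ∃ K : ℝ, 0 ≤ K ∧ ∀ (p δp : EuclideanSpace 𝕜 (Fin n)) (u : ℝ), 0 ≤ u → u ≤ 1 →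
      ∀ (δH : Matrix (Fin n) (Fin n) 𝕜) (δe δc : EuclideanSpace 𝕜 (Fin n)),
        ‖δH‖ ≤ a * u → ‖δe‖ ≤ a * u → ‖δc‖ ≤ a * ‖coeffVec p‖ * u →
        chebPoly (p + δp) = C ((2 : 𝕜) ^ (n - 1)) * (perturbedColleague p δH δe δc).charpoly →
        ‖δp‖ ≤ 48 * a * (n : ℝ) ^ 3 * (1 + ‖p‖) * u + K * (1 + ‖p‖) * u ^ 2 := by
  -- `a * u` may exceed `1`, hence the cap `B = a + 1`, which depends only on `a`.
  obtain ⟨K, hK, hbound⟩ := exists_norm_apply_le (𝕜 := 𝕜) hn (B := a + 1) (by linarith)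
  refine ⟨8 * √n * K * a ^ 2, by positivity, fun p δp u hu hu1 δH δe δc hδH hδe hδc hp => ?_⟩
  have h := hbound p δp δH δe δc (a * u) (a * u) (a * ‖coeffVec p‖ * u) hδH
    ((mul_le_of_le_one_right ha hu1).trans (by linarith)) hδe hδc hp
  have hCp : ‖coeffVec p‖ ≤ 2 * ‖p‖ := (norm_coeffVec_le p).trans
    (mul_le_mul_of_nonneg_right (Real.sqrt_le_iff.2 ⟨zero_le_two, by norm_num⟩) (norm_nonneg _))
  have hC0 := norm_nonneg (coeffVec p)
  set C := ‖coeffVec p‖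
  set w := √(n : ℝ)
  have hw2 : w ^ 2 = n := Real.sq_sqrt (Nat.cast_nonneg n)
  have hw1 : 1 ≤ w := Real.one_le_sqrt.2 (by exact_mod_cast (by omega : 1 ≤ n))
  have hQ : secondOrderBound C (a * u) (a * u) (a * C * u) = a ^ 2 * u ^ 2 * (1 + 4 * C) := by
    rw [secondOrderBound]
    ring
  rw [hQ] at h
  -- Passing to the Euclidean norm costs one `√n` and the coefficient bound contains another;
  -- together they raise `n ^ 2` to `n ^ 3`. The constant `48` is `24 * 2`, from `C ≤ 2 ‖p‖`.
  have h1 : w * (6 * C + 2 * w * C + (5 + 16 * w * C)) ≤ n * (48 * (1 + ‖p‖)) := by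
    have : 6 * C + 5 ≤ w * (6 * C + 5) := le_mul_of_one_le_left (by positivity) hw1
    have h2 : w * (24 * C + 5) ≤ w * (48 * (1 + ‖p‖)) := by
      gcongr
      linarith
    calc _ ≤ w * (w * (48 * (1 + ‖p‖))) :=
          mul_le_mul_of_nonneg_left (by linarith) (Real.sqrt_nonneg _)
      _ = _ := by rw [← hw2]; ring
  calc ‖δp‖ ≤ w * _ := norm_le_sqrt_mul_of_forall_norm_apply_le δp (by positivity) h
    _ = w * (6 * C + 2 * w * C + (5 + 16 * w * C)) * (n ^ 2 * a * u) +
        w * K * a ^ 2 * u ^ 2 * (1 + 4 * C) := by ring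
    _ ≤ n * (48 * (1 + ‖p‖)) * (n ^ 2 * a * u) + w * K * a ^ 2 * u ^ 2 * (8 * (1 + ‖p‖)) := by
        gcongr
        linarith
    _ = _ := by ring

end Colleague

theorem mainTheorem1 (𝕜 : Type*) [RCLike 𝕜] :
    -- the perturbed matrix linearizes `p + δp`, with a first order bound on each coefficient
    (∀ n : ℕ, 2 ≤ n → ∃ K : ℝ, 0 ≤ K ∧ ∀ p : EuclideanSpace 𝕜 (Fin n), ∃ r : ℝ, 0 < r ∧
      ∀ (δH : Matrix (Fin n) (Fin n) 𝕜) (δe δc : EuclideanSpace 𝕜 (Fin n)) (εH ε1 εc : ℝ),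
        ‖δH‖ ≤ εH → εH < 1 → ‖δe‖ ≤ ε1 → ‖δc‖ ≤ εc →
        ∃ δp : EuclideanSpace 𝕜 (Fin n),
          Colleague.chebPoly (p + δp) =
            Polynomial.C ((2 : 𝕜) ^ (n - 1)) *
              (Colleague.perturbedColleague p δH δe δc).charpoly ∧
          (εH < r → ε1 < r → εc < r →
            Colleague.IsStrongLinearization (Colleague.perturbedColleague p δH δe δc)
              (Colleague.chebPoly (p + δp))) ∧
          ∀ j : Fin n, ‖δp j‖ ≤
            (6 * ‖Colleague.coeffVec p‖ * ε1 + 2 * Real.sqrt n * εc +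
              (5 + 16 * Real.sqrt n * ‖Colleague.coeffVec p‖) * εH) * (n : ℝ) ^ 2 +
            K * (1 + ‖Colleague.coeffVec p‖) * (εH ^ 2 + ε1 ^ 2 + εc ^ 2)) ∧
    -- backward stability, when the errors on `H` and `e₁` are bounded independently of `p`
    -- and the error on `c` is bounded relatively to `c`
    (∃ κ : ℝ, 0 ≤ κ ∧ ∀ n : ℕ, 2 ≤ n → ∀ a : ℝ, 0 ≤ a → ∃ K : ℝ, 0 ≤ K ∧
      ∀ (p : EuclideanSpace 𝕜 (Fin n)) (u : ℝ), 0 ≤ u → u ≤ 1 →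
      ∀ (δH : Matrix (Fin n) (Fin n) 𝕜) (δe δc : EuclideanSpace 𝕜 (Fin n)),
        ‖δH‖ ≤ a * u → ‖δe‖ ≤ a * u → ‖δc‖ ≤ a * ‖Colleague.coeffVec p‖ * u →
        ∃ δp : EuclideanSpace 𝕜 (Fin n),
          Colleague.chebPoly (p + δp) =
            Polynomial.C ((2 : 𝕜) ^ (n - 1)) *
              (Colleague.perturbedColleague p δH δe δc).charpoly ∧
          ‖δp‖ ≤ κ * a * (n : ℝ) ^ 3 * (1 + ‖p‖) * u + K * (1 + ‖p‖) * u ^ 2) := by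
  refine ⟨fun n hn => ?_, 48, by norm_num, fun n hn a ha => ?_⟩
  · obtain ⟨K, hK, hbound⟩ := Colleague.exists_norm_apply_le (𝕜 := 𝕜) hn le_rfl
    refine ⟨2 * K, by positivity, fun p => ?_⟩
    obtain ⟨r, hr, hunit⟩ := Colleague.exists_isUnit_krylovMatrix_perturbedColleague p
    refine ⟨r, hr, fun δH δe δc εH ε1 εc hδH hεH hδe hδc => ?_⟩
    obtain ⟨δp, hδp⟩ := Colleague.exists_add_chebPoly_eq_charpoly (by omega) p
      (Colleague.perturbedColleague p δH δe δc)
    refine ⟨δp, hδp, fun h1 h2 h3 => ?_, fun j => ?_⟩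
    · rw [hδp]
      exact Colleague.isStrongLinearization_of_isUnit_krylovMatrix (by omega) _ _
        (hunit δH δe δc (hδH.trans_lt h1) (hδe.trans_lt h2) (hδc.trans_lt h3))
        (pow_ne_zero _ two_ne_zero)
    · refine (hbound p δp δH δe δc εH ε1 εc hδH hεH.le hδe hδc hδp j).trans ?_
      have := mul_le_mul_of_nonneg_left (Colleague.secondOrderBound_le (ε := εH) (ε₁ := ε1)
        (εc := εc) (norm_nonneg (Colleague.coeffVec p))) hK
      linarith
  · obtain ⟨K, hK, hbound⟩ := Colleague.exists_norm_le_of_relative_perturbation 𝕜 hn ha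
    refine ⟨K, hK, fun p u hu hu1 δH δe δc hδH hδe hδc => ?_⟩
    obtain ⟨δp, hδp⟩ := Colleague.exists_add_chebPoly_eq_charpoly (by omega) p
      (Colleague.perturbedColleague p δH δe δc)
    exact ⟨δp, hδp, hbound p δp u hu hu1 δH δe δc hδH hδe hδc hδp⟩
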